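/- For $k\ge 0$ let $\Omega_k=\mathbb Q[x_1,\dots,x_k]\otimes\bigwedge(s_1,\dots,s_k)$ be the bigraded superring in which $x_i$ is even of degree $(2i,0)$ and $s_i$ is odd of degree $(-2i,2)$ (quantum degree, $\lambda$-degree). Let $\mathcal M_k$ be the category of left $\Omega_k$-supermodules that are $\mathbb Z\times\mathbb Z$-graded, finite-dimensional in each degree and bounded from below in both gradings, with degree-preserving even maps, and let $\mathcal M=\bigoplus_{k\ge0}\mathcal M_k$. Write $\langle i,j\rangle$ for the shift of the gradings up by $(i,j)$, $\Pi$ for the parity shift, and $S_k=\mathbb Q$ for the simple object of $\mathcal M_k$. For objects $M,N$ of $\mathcal M$ let $\mathrm{HOM}_{\mathcal M}(M,N)=\bigoplus_{i,j,p}\mathrm{HOM}(M,N)_{i,j,p}$, where $\mathrm{HOM}(M,N)_{i,j,p}=\mathrm{Hom}_{\mathcal M}(M\langle i,j\rangle,\Pi^pN)$ is the space of homogeneous supermodule maps of bidegree $(i,j)$ and parity $p\in\mathbb Z/2$. For a bigraded superspace $V$ that is finite-dimensional in each degree and bounded from below put $\mathrm{gdim}_{\pi=-1}V=\sum_{i,j,p}(-1)^p\lambda^jq^i\dim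 V_{i,j,p}$. Let $[n]=\frac{q^n-q^{-n}}{q-q^{-1}}$. Let $M(\lambda q^{-1})$ be the universal Verma module of $U_q(\mathfrak{sl}_2)$ over $\mathbb Q(q)[\lambda^{\pm1}]$, with canonical basis $m_0,m_1,\dots$ and action $Km_i=\lambda q^{-1-2i}m_i$, $Fm_i=[i+1]m_{i+1}$, $Em_0=0$, $Em_i=\frac{\lambda q^{-i}-\lambda^{-1}q^{i}}{q-q^{-1}}m_{i-1}$ for $i\geq 1$. Let $\bar{\ }$ be the $\mathbb Q$-linear involution of $\mathbb Q(q)[\lambda^{\pm1}]$ with $\bar q=q^{-1}$, $\bar\lambda=\lambda^{-1}$, and let $\tau$ be the antilinear antiautomorphism of $U_q(\mathfrak{sl}_2)$ with $\tau(E)=q^{-1}K^{-1}F$, $\tau(F)=q^{-1}KE$, $\tau(K)=K^{-1}$. **Theorem.** 1. There is a unique form $\langle-,-\rangle_\lambda$ on $M(\lambda q^{-1})$ with values in $\mathbb Q(q)[\lambda^{\pm1}]$ (the universal Shapovalov form), biadditive, with $f\langle x,y\rangle_\lambda=\langle\bar fx,y\rangle_\lambda=\langle x,fy\rangle_\lambda$,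 $\langle m_0,m_0\rangle_\lambda=1$ and $\langle ux,y\rangle_\lambda=\langle x,\tau(u)y\rangle_\lambda$ for all $u\in U_q(\mathfrak{sl}_2)$. Extend it linearly in the second variable to the completed Verma module $\widehat M=\mathbb Q((q))((\lambda))\otimes M(\lambda q^{-1})$, expanding rational functions at $q=0$. There is a unique dual canonical basis $m^0,m^1,\dots\in\widehat M$ with $\langle m_i,m^j\rangle_\lambda=\delta_{ij}$. 2. There is a unique additive map $\gamma:K_0\to M(\lambda q^{-1})$, $M\mapsto[M]$, on the split Grothendieck group of finitely generated projective objects of $\mathcal M$ that sends $\bigoplus_a\Pi^{p_a}\Omega_k\langle i_a,j_a\rangle$ in $\mathcal M_k$ to $\sum_a(-1)^{p_a}q^{i_a}\lambda^{j_a}m_k$. In particular $[\Omega_k]=m_k$, and every finitely generated projective object of $\mathcal M_k$ has this form. 3. There is a unique additive map $\gamma':G_0(\mathcal M)\to\widehat M$, $N\mapsto[N]$, on the Grothendieck group of $\mathcal M$ with $[N]=\sum_k(\mathrm{gdim}_{\pi=-1}N_k)\,m^k$ for $N=\bigoplus_kN_k$, i.e. with $[S_k]=m^k$ and $[N]$ given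 by the composition multiplicities of $N$. If all $N_k$ are projective, then $N_k\cong\bigoplus_{a\in A_k}\Pi^{p_a}\Omega_k\langle i_a,j_a\rangle$ is a locally finite direct sum for each $k$, and $[N]=\sum_k\bigl(\sum_{a\in A_k}(-1)^{p_a}q^{i_a}\lambda^{j_a}\bigr)m_k$. 4. For every finitely generated projective object $M$ and every object $N$ of $\mathcal M$, the space $\mathrm{HOM}_{\mathcal M}(M,N)$ is finite-dimensional in each degree and bounded from below, and $$\langle[M],[N]\rangle_\lambda=\mathrm{gdim}_{\pi=-1}\mathrm{HOM}_{\mathcal M}(M,N).$$ -/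

import Mathlib

open scoped TensorProduct

universe u

noncomputable section

namespace VermaCat

/-! ## Coefficient rings -/

/-- The field `ℚ(q)`. -/
abbrev Kq : Type := RatFunc ℚ

/-- The indeterminate `q`. -/
def q : Kq := RatFunc.X

/-- The quantum integer `[n] = (q^n - q^{-n}) / (q - q^{-1})`. -/
def qint (n : ℤ) : Kq := (q ^ n - q ^ (-n)) / (q - q⁻¹)

lemma q_ne_zero : q ≠ 0 := RatFunc.X_ne_zero

lemma evalInv_injective :
    Function.Injective (Polynomial.eval₂RingHom (algebraMap ℚ Kq) q⁻¹) := by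
  have h : Transcendental ℚ (q⁻¹ : Kq) := by
    intro h
    refine RatFunc.transcendental_X (K := ℚ) ?_
    have h1 : IsAlgebraic ℚ q := IsAlgebraic.inv_iff.1 (by convert h)
    have e : (RatFunc.instAlgebraOfPolynomial ℚ ℚ : Algebra ℚ Kq) = DivisionRing.toRatAlgebra :=
      Subsingleton.elim _ _
    rw [e]
    exact h1
  have h2 := transcendental_iff_injective.1 h
  intro x y hxy
  apply h2
  simpa [Polynomial.aeval_def] using hxy

/-- The bar involution of `ℚ(q)`, the `ℚ`-linear field automorphism with `q ↦ q⁻¹`. -/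
def barK : Kq →+* Kq :=
  RatFunc.liftRingHom (Polynomial.eval₂RingHom (algebraMap ℚ Kq) q⁻¹)
    (nonZeroDivisors_le_comap_nonZeroDivisors_of_injective _ evalInv_injective)

lemma barK_q : barK q = q⁻¹ := by
  simp [barK, q]

lemma q_sub_inv_ne_zero : q - q⁻¹ ≠ 0 := by
  intro h
  have h2 : q ^ 2 = 1 := by
    have h3 := q_ne_zero
    field_simp at h
    linear_combination h
  have h3 : algebraMap (Polynomial ℚ) Kq (Polynomial.X ^ 2) = algebraMap (Polynomial ℚ) Kq 1 := by
    simpa [q] using h2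
  have h4 := RatFunc.algebraMap_injective ℚ h3
  have h5 := congrArg (Polynomial.eval (2 : ℚ)) h4
  norm_num at h5

/-- The ring `ℚ(q)[λ, λ⁻¹]`; the variable `λ` is `LaurentPolynomial.T 1`. -/
abbrev KL : Type := LaurentPolynomial Kq

/-- `λ` as a unit. -/
def lamUnit : KLˣ where
  val := LaurentPolynomial.T 1
  inv := LaurentPolynomial.T (-1)
  val_inv := by rw [← LaurentPolynomial.T_add]; simp
  inv_val := by rw [← LaurentPolynomial.T_add]; simp

/-- The bar involution of `ℚ(q)[λ, λ⁻¹]`: `q ↦ q⁻¹`, `λ ↦ λ⁻¹`. -/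
def bar : KL →+* KL :=
  LaurentPolynomial.eval₂ (LaurentPolynomial.C.comp barK) lamUnit⁻¹

/-- `[λ, n] = (λ q^n - λ⁻¹ q^{-n}) / (q - q⁻¹)`. -/
def lamint (n : ℤ) : KL :=
  LaurentPolynomial.C (q ^ n / (q - q⁻¹)) * LaurentPolynomial.T 1 -
    LaurentPolynomial.C (q ^ (-n) / (q - q⁻¹)) * LaurentPolynomial.T (-1)

/-- The field of iterated Laurent series `ℚ((q))((λ))`: the coefficient of `q^i λ^j` of `c` is
`(c.coeff j).coeff i`. It contains `ℚ⟦q⟧[q⁻¹, λ^{±1}]` and `ℚ⟦q, λ⟧[q⁻¹, λ⁻¹]`. -/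
abbrev Ser : Type := LaurentSeries (LaurentSeries ℚ)

/-- `λ` as a unit of `ℚ((q))((λ))`. -/
def serLam : Serˣ :=
  Units.mk0 (HahnSeries.single (1 : ℤ) (1 : LaurentSeries ℚ)) (by simp)

open scoped RatFunc in
/-- The expansion of a rational function in `q` at `q = 0`. -/
def expandK : Kq →+* LaurentSeries ℚ := algebraMap (RatFunc ℚ) (LaurentSeries ℚ)

/-- The embedding of `ℚ(q)[λ, λ⁻¹]` into `ℚ((q))((λ))`. -/
def expand : KL →+* Ser :=
  LaurentPolynomial.eval₂ ((HahnSeries.C (Γ := ℤ) (R := LaurentSeries ℚ)).comp expandK) serLam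

/-! ## Quantum `sl₂` -/

/-- The generators `E`, `F`, `K`, `K⁻¹`. -/
inductive Gen : Type
  | E | F | K | Kinv

/-- The free algebra on the generators. -/
abbrev FreeU : Type := FreeAlgebra Kq Gen

/-- A generator in the free algebra. -/
abbrev g (x : Gen) : FreeU := FreeAlgebra.ι Kq x

/-- The defining relations of `U_q(sl₂)`. -/
inductive Rel : FreeU → FreeU → Prop
  | KKinv : Rel (g .K * g .Kinv) 1
  | KinvK : Rel (g .Kinv * g .K) 1
  | KE : Rel (g .K * g .E) (q ^ 2 • (g .E * g .K))
  | KF : Rel (g .K * g .F) (q⁻¹ ^ 2 • (g .F * g .K))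
  | EF : Rel (g .E * g .F - g .F * g .E) ((q - q⁻¹)⁻¹ • (g .K - g .Kinv))

/-- The quantum algebra `U_q(sl₂)` over `ℚ(q)`. -/
abbrev Uq : Type := RingQuot Rel

/-- The image of a generator in `U_q(sl₂)`. -/
def u (x : Gen) : Uq := RingQuot.mkAlgHom Kq Rel (g x)

lemma u_KKinv : u .K * u .Kinv = 1 := by
  simpa [u] using RingQuot.mkAlgHom_rel Kq Rel.KKinv
lemma u_KinvK : u .Kinv * u .K = 1 := by
  simpa [u] using RingQuot.mkAlgHom_rel Kq Rel.KinvK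
lemma u_KE : u .K * u .E = q ^ 2 • (u .E * u .K) := by
  simpa [u] using RingQuot.mkAlgHom_rel Kq Rel.KE
lemma u_KF : u .K * u .F = q⁻¹ ^ 2 • (u .F * u .K) := by
  simpa [u] using RingQuot.mkAlgHom_rel Kq Rel.KF
lemma u_EF : u .E * u .F - u .F * u .E = (q - q⁻¹)⁻¹ • (u .K - u .Kinv) := by
  simpa [u] using RingQuot.mkAlgHom_rel Kq Rel.EF

/-- Values of the antiautomorphism `τ` on generators:
`τ(E) = q⁻¹K⁻¹F`, `τ(F) = q⁻¹KE`, `τ(K) = K⁻¹`. -/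
def tauGen : Gen → Uq
  | .E => q⁻¹ • (u .Kinv * u .F)
  | .F => q⁻¹ • (u .K * u .E)
  | .K => u .Kinv
  | .Kinv => u .K

/-- The extension of `tauGen` to a `ℚ(q)`-antilinear ring homomorphism on the free algebra, with
values in the opposite algebra. -/
def tauFree : FreeU →+* Uqᵐᵒᵖ :=
  letI : Algebra Kq Uqᵐᵒᵖ := Algebra.compHom Uqᵐᵒᵖ barK
  (FreeAlgebra.lift Kq (fun x => MulOpposite.op (tauGen x)) : FreeU →ₐ[Kq] Uqᵐᵒᵖ).toRingHom

lemma tauFree_g (x : Gen) : (tauFree (g x)).unop = tauGen x := by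
  let i : Algebra Kq Uqᵐᵒᵖ := Algebra.compHom Uqᵐᵒᵖ barK
  exact congrArg MulOpposite.unop
    (FreeAlgebra.lift_ι_apply (R := Kq) (A := Uqᵐᵒᵖ) (fun x => MulOpposite.op (tauGen x)) x)

lemma tauFree_algebraMap (c : Kq) :
    (tauFree (algebraMap Kq FreeU c)).unop = algebraMap Kq Uq (barK c) := by
  let i : Algebra Kq Uqᵐᵒᵖ := Algebra.compHom Uqᵐᵒᵖ barK
  exact congrArg MulOpposite.unop
    ((FreeAlgebra.lift Kq (fun x => MulOpposite.op (tauGen x)) : FreeU →ₐ[Kq] Uqᵐᵒᵖ).commutes c)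

lemma tauFree_smul (c : Kq) (x : FreeU) :
    (tauFree (c • x)).unop = barK c • (tauFree x).unop := by
  rw [Algebra.smul_def, map_mul, MulOpposite.unop_mul, tauFree_algebraMap, Algebra.smul_def,
    Algebra.commutes]

lemma u_FKinv : u .F * u .Kinv = q⁻¹ ^ 2 • (u .Kinv * u .F) := by
  have h := congrArg (fun z => u .Kinv * z * u .Kinv) u_KF
  simp only [mul_smul_comm, smul_mul_assoc] at h
  calc u .F * u .Kinv = (u .Kinv * u .K) * (u .F * u .Kinv) := by rw [u_KinvK, one_mul]
    _ = u .Kinv * (u .K * u .F) * u .Kinv := by simp only [mul_assoc]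
    _ = q⁻¹ ^ 2 • (u .Kinv * (u .F * u .K) * u .Kinv) := h
    _ = q⁻¹ ^ 2 • (u .Kinv * u .F * (u .K * u .Kinv)) := by simp only [mul_assoc]
    _ = _ := by rw [u_KKinv, mul_one]

lemma tauFree_rel ⦃x y : FreeU⦄ (h : Rel x y) : tauFree x = tauFree y := by
  have hq := q_ne_zero
  have hq2 : q ^ 2 ≠ 0 := pow_ne_zero 2 hq
  have hb := barK_q
  apply MulOpposite.unop_injective
  have hKEK : u .K * u .E * u .Kinv = q ^ 2 • u .E := by
    rw [u_KE, smul_mul_assoc, mul_assoc, u_KKinv, mul_one]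
  have hKFK : u .Kinv * u .F * u .K = q ^ 2 • u .F := by
    have : u .Kinv * u .F = q ^ 2 • (u .F * u .Kinv) := by
      rw [u_FKinv, smul_smul, ← mul_pow, mul_inv_cancel₀ hq, one_pow, one_smul]
    rw [this, smul_mul_assoc, mul_assoc, u_KinvK, mul_one]
  cases h with
  | KKinv => simp [tauFree_g, tauGen, u_KKinv]
  | KinvK => simp [tauFree_g, tauGen, u_KinvK]
  | KE =>
    rw [tauFree_smul, map_mul, map_mul, MulOpposite.unop_mul, MulOpposite.unop_mul, map_pow, hb]
    simp only [tauFree_g, tauGen]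
    rw [smul_mul_assoc, mul_assoc, u_FKinv, mul_smul_comm, mul_smul_comm, smul_comm]
  | KF =>
    rw [tauFree_smul, map_mul, map_mul, MulOpposite.unop_mul, MulOpposite.unop_mul, map_pow,
      map_inv₀, hb, inv_inv]
    simp only [tauFree_g, tauGen]
    rw [smul_mul_assoc, hKEK, mul_smul_comm, ← mul_assoc, u_KinvK, one_mul, smul_comm]
  | EF =>
    rw [tauFree_smul, map_sub, map_sub, map_mul, map_mul, MulOpposite.unop_sub,
      MulOpposite.unop_sub, MulOpposite.unop_mul, MulOpposite.unop_mul, map_inv₀, map_sub,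
      map_inv₀, hb, inv_inv]
    simp only [tauFree_g, tauGen]
    have e1 : (q⁻¹ • (u .K * u .E)) * (q⁻¹ • (u .Kinv * u .F)) = u .E * u .F := by
      rw [smul_mul_smul_comm, ← mul_assoc, hKEK, smul_mul_assoc, smul_smul]
      have : q⁻¹ * q⁻¹ * q ^ 2 = 1 := by field_simp
      rw [this, one_smul]
    have e2 : (q⁻¹ • (u .Kinv * u .F)) * (q⁻¹ • (u .K * u .E)) = u .F * u .E := by
      rw [smul_mul_smul_comm, ← mul_assoc, hKFK, smul_mul_assoc, smul_smul]
      have : q⁻¹ * q⁻¹ * q ^ 2 = 1 := by field_simp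
      rw [this, one_smul]
    rw [e1, e2, u_EF, ← neg_sub q q⁻¹, inv_neg, ← neg_sub (u .K) (u .Kinv), smul_neg, neg_smul,
      neg_neg]

/-- The `ℚ(q)`-antilinear antiautomorphism `τ` of `U_q(sl₂)` with `τ(E) = q⁻¹K⁻¹F`,
`τ(F) = q⁻¹KE`, `τ(K) = K⁻¹`. -/
def tau (x : Uq) : Uq := (RingQuot.lift ⟨tauFree, tauFree_rel⟩ x).unop

lemma tau_u (x : Gen) : tau (u x) = tauGen x := by
  rw [tau, u, ← AlgHom.coe_toRingHom, RingQuot.mkAlgHom_coe, RingQuot.lift_mkRingHom_apply,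
    tauFree_g]

/-! ## The universal Verma module `M(λq⁻¹)` -/

/-- The underlying module of the universal Verma module with coefficients in `A`, with canonical
basis `m i = Finsupp.single i 1`. -/
abbrev Verma (A : Type) [CommRing A] : Type := ℕ →₀ A

/-- The canonical basis element `m_i`. -/
abbrev m {A : Type} [CommRing A] (i : ℕ) : Verma A := Finsupp.single i 1

/-- Action of the generators on `M(λq⁻¹)` over `ℚ(q)[λ, λ⁻¹]`:
`K m_i = λ q^{-1-2i} m_i`, `F m_i = [i+1] m_{i+1}`, and `E m_i = [λ, -i] m_{i-1}`, `E m_0 = 0`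
(that is, `E m_i = (μ q^{1-i} - μ⁻¹ q^{i-1}) / (q - q⁻¹) m_{i-1}` with `μ = λq⁻¹`). -/
def actGen : Gen → Module.End KL (Verma KL)
  | .K => Finsupp.lift (Verma KL) KL ℕ fun i =>
      Finsupp.single i (LaurentPolynomial.C (q ^ (-1 - 2 * (i : ℤ))) * LaurentPolynomial.T 1)
  | .Kinv => Finsupp.lift (Verma KL) KL ℕ fun i =>
      Finsupp.single i (LaurentPolynomial.C (q ^ (1 + 2 * (i : ℤ))) * LaurentPolynomial.T (-1))
  | .F => Finsupp.lift (Verma KL) KL ℕ fun i =>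
      Finsupp.single (i + 1) (LaurentPolynomial.C (qint ((i : ℤ) + 1)))
  | .E => Finsupp.lift (Verma KL) KL ℕ fun i =>
      if i = 0 then 0 else Finsupp.single (i - 1) (lamint (-(i : ℤ)))

/-- The action extended to the free algebra. -/
def actFree : FreeU →ₐ[Kq] Module.End KL (Verma KL) := FreeAlgebra.lift Kq actGen

lemma actFree_g (x : Gen) : actFree (g x) = actGen x := by
  simp [actFree]

lemma actGen_single (x : Gen) (i : ℕ) (c : KL) :
    actGen x (Finsupp.single i c) = c • actGen x (m i) := by
  rw [← map_smul]; simp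

lemma actK_m (i : ℕ) : actGen .K (m i) =
    (LaurentPolynomial.C (q ^ (-1 - 2 * (i : ℤ))) * LaurentPolynomial.T 1 : KL) • m i := by
  rw [Finsupp.smul_single, smul_eq_mul, mul_one]
  exact (Finsupp.sum_single_index (by simp)).trans (one_smul _ _)

lemma actKinv_m (i : ℕ) : actGen .Kinv (m i) =
    (LaurentPolynomial.C (q ^ (1 + 2 * (i : ℤ))) * LaurentPolynomial.T (-1) : KL) • m i := by
  rw [Finsupp.smul_single, smul_eq_mul, mul_one]
  exact (Finsupp.sum_single_index (by simp)).trans (one_smul _ _)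

lemma actF_m (i : ℕ) : actGen .F (m i) =
    (LaurentPolynomial.C (qint ((i : ℤ) + 1)) : KL) • m (i + 1) := by
  rw [Finsupp.smul_single, smul_eq_mul, mul_one]
  exact (Finsupp.sum_single_index (by simp)).trans (one_smul _ _)

lemma actE_m_zero : actGen .E (m 0) = 0 :=
  (Finsupp.sum_single_index (by simp)).trans (one_smul _ _)

lemma actE_m_succ (i : ℕ) : actGen .E (m (i + 1)) = lamint (-((i : ℤ) + 1)) • m i := by
  rw [Finsupp.smul_single, smul_eq_mul, mul_one]
  refine (Finsupp.sum_single_index (by simp)).trans ((one_smul _ _).trans ?_)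
  change (if i + 1 = 0 then 0 else Finsupp.single (i + 1 - 1) (lamint (-((i + 1 : ℕ) : ℤ)))) = _
  rw [if_neg (Nat.succ_ne_zero i)]
  push_cast
  rfl

lemma C_T_mul (a b : Kq) (i j : ℤ) :
    (LaurentPolynomial.C a * LaurentPolynomial.T i : KL) *
      (LaurentPolynomial.C b * LaurentPolynomial.T j) =
      LaurentPolynomial.C (a * b) * LaurentPolynomial.T (i + j) := by
  rw [map_mul, LaurentPolynomial.T_add]; ring

lemma Kq_smul (c : Kq) (v : Verma KL) : c • v = (LaurentPolynomial.C c : KL) • v := by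
  ext1 i
  rw [Finsupp.smul_apply, Finsupp.smul_apply, LaurentPolynomial.smul_eq_C_mul, smul_eq_mul]

lemma end_ext {f h : Module.End KL (Verma KL)} (H : ∀ i, f (m i) = h (m i)) : f = h := by
  apply Finsupp.lhom_ext
  intro i c
  have e : (Finsupp.single i c : Verma KL) = c • m i := by
    rw [Finsupp.smul_single, smul_eq_mul, mul_one]
  rw [e, map_smul, map_smul, H]

lemma qint_mul (n : ℤ) : qint (n + 1) * (q ^ (-(n + 1)) / (q - q⁻¹)) -
    qint n * (q ^ (-n) / (q - q⁻¹)) = (q - q⁻¹)⁻¹ * q ^ (-1 - 2 * n) := by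
  have hq := q_ne_zero
  have hs := q_sub_inv_ne_zero
  have e1 : q ^ (n + 1) * q ^ (-(n + 1)) = 1 := by rw [← zpow_add₀ hq]; simp
  have e2 : q ^ n * q ^ (-n) = 1 := by rw [← zpow_add₀ hq]; simp
  have e3 : q ^ (-(n + 1)) = q⁻¹ * q ^ (-n) := by
    rw [neg_add, zpow_add₀ hq, zpow_neg_one, mul_comm]
  have e4 : q ^ (-1 - 2 * n) = q⁻¹ * q ^ (-n) * q ^ (-n) := by
    rw [← zpow_neg_one, ← zpow_add₀ hq, ← zpow_add₀ hq]; congr 1; ring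
  have e5 : q * q⁻¹ = 1 := mul_inv_cancel₀ hq
  unfold qint
  have : (q - q⁻¹) * (q - q⁻¹)⁻¹ = 1 := mul_inv_cancel₀ hs
  rw [e4]
  simp only [div_eq_mul_inv]
  generalize (q - q⁻¹)⁻¹ = s at *
  rw [sub_mul, sub_mul]
  rw [e3] at e1 ⊢
  generalize q ^ (n + 1) = x at *
  generalize q ^ n = y at *
  generalize q ^ (-n) = z at *
  generalize q⁻¹ = r at *
  linear_combination s ^ 2 * e1 - s ^ 2 * e2 + s * r * z ^ 2 * this + s ^ 2 * z ^ 2 * (-1) * e5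

lemma qint_mul' (n : ℤ) : qint (n + 1) * (q ^ (n + 1) / (q - q⁻¹)) -
    qint n * (q ^ n / (q - q⁻¹)) = (q - q⁻¹)⁻¹ * q ^ (1 + 2 * n) := by
  have hq := q_ne_zero
  have hs := q_sub_inv_ne_zero
  have e1 : q ^ (n + 1) * q ^ (-(n + 1)) = 1 := by rw [← zpow_add₀ hq]; simp
  have e2 : q ^ n * q ^ (-n) = 1 := by rw [← zpow_add₀ hq]; simp
  have e3 : q ^ (n + 1) = q * q ^ n := by
    rw [zpow_add₀ hq, zpow_one, mul_comm]
  have e4 : q ^ (1 + 2 * n) = q * q ^ n * q ^ n := by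
    rw [zpow_add₀ hq, zpow_one, two_mul, zpow_add₀ hq, mul_assoc]
  have e5 : q * q⁻¹ = 1 := mul_inv_cancel₀ hq
  unfold qint
  have : (q - q⁻¹) * (q - q⁻¹)⁻¹ = 1 := mul_inv_cancel₀ hs
  rw [e4]
  simp only [div_eq_mul_inv]
  generalize (q - q⁻¹)⁻¹ = s at *
  rw [e3] at e1 ⊢
  generalize q ^ (-(n + 1)) = x at *
  generalize q ^ n = y at *
  generalize q ^ (-n) = z at *
  generalize q⁻¹ = r at *
  linear_combination -s ^ 2 * e1 + s ^ 2 * e2 + s * q * y ^ 2 * this + s ^ 2 * y ^ 2 * e5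

lemma lamint_comm (n : ℤ) :
    LaurentPolynomial.C (qint (n + 1)) * lamint (-(n + 1)) -
      lamint (-n) * LaurentPolynomial.C (qint n) =
    LaurentPolynomial.C (q - q⁻¹)⁻¹ *
      (LaurentPolynomial.C (q ^ (-1 - 2 * n)) * LaurentPolynomial.T 1 -
        LaurentPolynomial.C (q ^ (1 + 2 * n)) * LaurentPolynomial.T (-1)) := by
  have h1 := congrArg (LaurentPolynomial.C (R := Kq)) (qint_mul n)
  have h2 := congrArg (LaurentPolynomial.C (R := Kq)) (qint_mul' n)
  simp only [map_sub, map_mul] at h1 h2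
  unfold lamint
  rw [neg_neg, neg_neg]
  linear_combination LaurentPolynomial.T 1 * h1 - LaurentPolynomial.T (-1) * h2

lemma actFree_rel ⦃x y : FreeU⦄ (h : Rel x y) : actFree x = actFree y := by
  have hq := q_ne_zero
  apply end_ext
  intro i
  cases h with
  | KKinv =>
    rw [map_mul, map_one, actFree_g, actFree_g, Module.End.mul_apply, actKinv_m, map_smul, actK_m,
      smul_smul, C_T_mul, ← zpow_add₀ hq]
    simp
  | KinvK =>
    rw [map_mul, map_one, actFree_g, actFree_g, Module.End.mul_apply, actK_m, map_smul, actKinv_m,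
      smul_smul, C_T_mul, ← zpow_add₀ hq]
    simp
  | KE =>
    rw [map_smul, map_mul, map_mul, actFree_g, actFree_g, LinearMap.smul_apply,
      Module.End.mul_apply, Module.End.mul_apply, Kq_smul, actK_m, map_smul]
    cases i with
    | zero => rw [actE_m_zero]; simp
    | succ i =>
      rw [actE_m_succ, map_smul, actK_m, smul_smul, smul_smul, smul_smul]
      congr 1
      have : q ^ (-1 - 2 * (i : ℤ)) = q ^ 2 * q ^ (-1 - 2 * ((i + 1 : ℕ) : ℤ)) := by
        rw [← zpow_natCast, ← zpow_add₀ hq]; congr 1; push_cast; ring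
      rw [this, map_mul]
      ring
  | KF =>
    rw [map_smul, map_mul, map_mul, actFree_g, actFree_g, LinearMap.smul_apply,
      Module.End.mul_apply, Module.End.mul_apply, Kq_smul, actK_m, map_smul, actF_m, map_smul,
      actK_m, smul_smul, smul_smul, smul_smul]
    congr 1
    have : q ^ (-1 - 2 * ((i + 1 : ℕ) : ℤ)) = q⁻¹ ^ 2 * q ^ (-1 - 2 * (i : ℤ)) := by
      rw [inv_pow, ← zpow_natCast, ← zpow_neg, ← zpow_add₀ hq]; congr 1; push_cast; ring
    rw [this, map_mul]
    ring
  | EF =>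
    rw [map_smul, map_sub, map_sub, map_mul, map_mul, actFree_g, actFree_g, actFree_g, actFree_g,
      LinearMap.smul_apply, LinearMap.sub_apply, LinearMap.sub_apply,
      Module.End.mul_apply, Module.End.mul_apply, Kq_smul, actK_m, actKinv_m, actF_m, map_smul,
      actE_m_succ, smul_smul, ← sub_smul, smul_smul, ← lamint_comm, sub_smul]
    congr 1
    cases i with
    | zero => rw [actE_m_zero]; simp [qint]
    | succ i =>
      rw [actE_m_succ, map_smul, actF_m, smul_smul]
      push_cast
      rfl

/-- The action of `U_q(sl₂)` on the universal Verma module `M(λq⁻¹)`. -/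
def act : Uq →ₐ[Kq] Module.End KL (Verma KL) := RingQuot.liftAlgHom Kq ⟨actFree, actFree_rel⟩

lemma act_u (x : Gen) : act (u x) = actGen x := by
  rw [act, u, RingQuot.liftAlgHom_mkAlgHom_apply, actFree_g]

/-! ## The universal Shapovalov form -/

/-- The defining properties of the universal Shapovalov form on `M(λq⁻¹)` over `ℚ(q)[λ, λ⁻¹]`.
Forms are antilinear (with respect to the bar involution) in the first variable and linear in the
second one, i.e. `f ⟨x, y⟩ = ⟨bar f • x, y⟩ = ⟨x, f • y⟩`. -/
structure IsShapovalov (B : Verma KL →ₛₗ[bar] Verma KL →ₗ[KL] KL) : Prop where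
  one : B (m 0) (m 0) = 1
  adj : ∀ (a : Uq) (x y : Verma KL), B (act a x) y = B x (act (tau a) y)

/-- The extension of a form to the completed module `ℚ((q))((λ)) ⊗ M(λq⁻¹)` in the second,
linear, variable. -/
def extend (B : Verma KL →ₛₗ[bar] Verma KL →ₗ[KL] KL) (x : Verma KL) (y : Verma Ser) : Ser :=
  y.sum fun j c => c * expand (B x (m j))

/-- `d` is the dual canonical basis: `⟨m_i, m^j⟩ = δ_{ij}`. -/
def IsDualCanonical (B : Verma KL →ₛₗ[bar] Verma KL →ₗ[KL] KL) (d : ℕ → Verma Ser) : Prop :=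
  ∀ i j, extend B (m i) (d j) = if i = j then 1 else 0

/-! ## The superrings `Ω_k` and their bigraded supermodules -/

/-- Degrees: (quantum degree, `λ`-degree, parity). -/
abbrev Deg : Type := ℤ × ℤ × ZMod 2

/-- The superring `Ω_k = ℚ[x_1, …, x_k] ⊗ ⋀(s_1, …, s_k)`; the generators are indexed by
`Fin k`, so that the index `i : Fin k` stands for `x_{i+1}` and `s_{i+1}`. -/
abbrev Omega (k : ℕ) : Type := MvPolynomial (Fin k) ℚ ⊗[ℚ] ExteriorAlgebra ℚ (Fin k → ℚ)

/-- The basis of `Ω_k` of monomials `x^α s_{i_1} ∧ ⋯ ∧ s_{i_r}` with `i_1 < ⋯ < i_r`. -/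
def omegaBasis (k : ℕ) : Module.Basis ((Fin k →₀ ℕ) × Finset (Fin k)) ℚ (Omega k) :=
  (MvPolynomial.basisMonomials (Fin k) ℚ).tensorProduct (Pi.basisFun ℚ (Fin k)).ExteriorAlgebra

/-- Degree of a monomial: `x_i` has degree `(2i, 0)` and is even, `s_i` has degree `(-2i, 2)` and
is odd. -/
def monDeg {k : ℕ} (a : (Fin k →₀ ℕ) × Finset (Fin k)) : Deg :=
  (∑ i : Fin k, 2 * ((i : ℤ) + 1) * (a.1 i : ℤ) - ∑ i ∈ a.2, 2 * ((i : ℤ) + 1), 2 * (a.2.card : ℤ),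
    (a.2.card : ZMod 2))

/-- The homogeneous component of degree `d` of `Ω_k`. -/
def omegaGr (k : ℕ) (d : Deg) : Submodule ℚ (Omega k) :=
  Submodule.span ℚ (omegaBasis k '' {a | monDeg a = d})

/-- An object of the category of bigraded, locally finite-dimensional, left bounded (left)
`Ω_k`-supermodules. -/
structure SMod (k : ℕ) : Type (u + 1) where
  carrier : Type u
  [addCommGroup : AddCommGroup carrier]
  [moduleRat : Module ℚ carrier]
  [moduleOmega : Module (Omega k) carrier]
  [tower : IsScalarTower ℚ (Omega k) carrier]
  gr : Deg → Submodule ℚ carrier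
  internal : DirectSum.IsInternal gr
  smul_mem : ∀ (d e : Deg) (r : Omega k) (v : carrier),
    r ∈ omegaGr k d → v ∈ gr e → r • v ∈ gr (d + e)
  locallyFinite : ∀ d, Module.Finite ℚ (gr d)
  leftBounded : ∃ a b : ℤ, ∀ i j p, i < a ∨ j < b → gr (i, j, p) = ⊥

attribute [instance] SMod.addCommGroup SMod.moduleRat SMod.moduleOmega SMod.tower

/-- The sign `(-1)^{pp'}`. -/
def koszul (p p' : ZMod 2) : ℚ := if p = 1 ∧ p' = 1 then -1 else 1

/-- The space of homogeneous supermodule maps `M → N` of degree `d` (bidegree and parity):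
`f(M_e) ⊆ N_{d+e}` and `f(r v) = (-1)^{p(f)p(r)} r f(v)`. -/
def homGr {k : ℕ} (M N : SMod.{u} k) (d : Deg) : Submodule ℚ (M.carrier →ₗ[ℚ] N.carrier) where
  carrier := {f | (∀ e, ∀ v ∈ M.gr e, f v ∈ N.gr (d + e)) ∧
    ∀ (e : Deg) (r : Omega k) (v : M.carrier), r ∈ omegaGr k e →
      f (r • v) = koszul d.2.2 e.2.2 • r • f v}
  zero_mem' := ⟨fun e v _ => by simp, fun e r v _ => by simp⟩
  add_mem' := fun {f f'} hf hf' => ⟨fun e v hv => add_mem (hf.1 e v hv) (hf'.1 e v hv),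
    fun e r v hr => by
      simp only [LinearMap.add_apply, smul_add, hf.2 e r v hr, hf'.2 e r v hr]⟩
  smul_mem' := fun c f hf => ⟨fun e v hv => Submodule.smul_mem _ _ (hf.1 e v hv),
    fun e r v hr => by
      simp only [LinearMap.smul_apply, hf.2 e r v hr]
      rw [smul_comm c, ← algebraMap_smul (Omega k) c (r • f v), ← algebraMap_smul (Omega k) c (f v),
        smul_smul, smul_smul, Algebra.commutes]⟩

/-- An object of `𝓜 = ⨁_k 𝓜_k`: a family of objects of `𝓜_k`, almost all of them zero. -/
structure CatM : Type (u + 1) where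
  comp : (k : ℕ) → SMod.{u} k
  finite : {k | ¬ Subsingleton (comp k).carrier}.Finite

/-- The component of degree `d = (i, j, p)` of the enriched space `HOM_𝓜(M, N)`: homogeneous maps of
degree `d`, that is, degree-preserving even maps `M⟨i, j⟩ → Π^p N`. -/
abbrev HOM (M N : CatM.{u}) (d : Deg) : Type u := (k : ℕ) → homGr (M.comp k) (N.comp k) d

/-- A graded vector space is finite-dimensional in each degree and bounded from below. -/
def IsLocallyFiniteBounded (V : Deg → Type u) [∀ d, AddCommGroup (V d)] [∀ d, Module ℚ (V d)] :
    Prop :=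
  (∀ d, Module.Finite ℚ (V d)) ∧ ∃ a b : ℤ, ∀ i j p, i < a ∨ j < b → Subsingleton (V (i, j, p))

/-- `c` is the graded dimension `∑ π^p λ^j q^i dim V_{i,j,p}` at `π = -1`. -/
def IsGdim (V : Deg → Type u) [∀ d, AddCommGroup (V d)] [∀ d, Module ℚ (V d)] (c : Ser) : Prop :=
  ∀ i j : ℤ, (c.coeff j).coeff i =
    (Module.finrank ℚ (V (i, j, 0)) : ℚ) - (Module.finrank ℚ (V (i, j, 1)) : ℚ)

/-! ## Grothendieck groups -/

/-- Finitely generated projective objects of `𝓜`. -/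
def IsFgProj (M : CatM.{u}) : Prop :=
  ∀ k, Module.Finite (Omega k) (M.comp k).carrier ∧ Module.Projective (Omega k) (M.comp k).carrier

/-- Projective objects of `𝓜`. -/
def IsProj (M : CatM.{u}) : Prop := ∀ k, Module.Projective (Omega k) (M.comp k).carrier

/-- `B ≅ A ⊕ C` in `𝓜`. -/
def IsDirectSum (A B C : CatM.{u}) : Prop :=
  ∀ k, ∃ e : (B.comp k).carrier ≃ₗ[Omega k] (A.comp k).carrier × (C.comp k).carrier,
    ∀ d v, v ∈ (B.comp k).gr d ↔ (e v).1 ∈ (A.comp k).gr d ∧ (e v).2 ∈ (C.comp k).gr d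

/-- There is a short exact sequence `0 → A → B → C → 0` in `𝓜`. -/
def IsShortExact (A B C : CatM.{u}) : Prop :=
  ∀ k, ∃ (f : (A.comp k).carrier →ₗ[Omega k] (B.comp k).carrier)
    (h : (B.comp k).carrier →ₗ[Omega k] (C.comp k).carrier),
    (∀ d, ∀ v ∈ (A.comp k).gr d, f v ∈ (B.comp k).gr d) ∧
    (∀ d, ∀ v ∈ (B.comp k).gr d, h v ∈ (C.comp k).gr d) ∧
    Function.Injective f ∧ Function.Exact f h ∧ Function.Surjective h

/-- The split Grothendieck group of finitely generated projective objects. -/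
abbrev K0 : Type (u + 1) :=
  FreeAbelianGroup {M : CatM.{u} // IsFgProj M} ⧸ AddSubgroup.closure
    {z | ∃ A B C : {M : CatM.{u} // IsFgProj M}, IsDirectSum A.1 B.1 C.1 ∧
      z = FreeAbelianGroup.of B - FreeAbelianGroup.of A - FreeAbelianGroup.of C}

/-- The class of an object in `K0`. -/
def K0.mk (M : {M : CatM.{u} // IsFgProj M}) : K0.{u} :=
  QuotientAddGroup.mk (FreeAbelianGroup.of M)

/-- The Grothendieck group of `𝓜`. -/
abbrev G0 : Type (u + 1) :=
  FreeAbelianGroup CatM.{u} ⧸ AddSubgroup.closure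
    {z | ∃ A B C : CatM.{u}, IsShortExact A B C ∧
      z = FreeAbelianGroup.of B - FreeAbelianGroup.of A - FreeAbelianGroup.of C}

/-- The class of an object in `G0`. -/
def G0.mk (N : CatM.{u}) : G0.{u} := QuotientAddGroup.mk (FreeAbelianGroup.of N)

/-- `P ≅ ⨁_a Π^{p_a} Ω_k⟨i_a, j_a⟩` is a locally finite direct sum, i.e. `P` has a homogeneous
`Ω_k`-basis with elements of degrees `(i_a, j_a, p_a)`, and `c = ∑_a (-1)^{p_a} q^{i_a} λ^{j_a}`,
so that `[P] = c [Ω_k]` at `π = -1`. -/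
def HasMult {k : ℕ} (P : SMod.{u} k) (c : Ser) : Prop :=
  ∃ (A : Type u) (b : Module.Basis A (Omega k) P.carrier) (deg : A → Deg),
    (∀ a, b a ∈ P.gr (deg a)) ∧ (∀ d, {a | deg a = d}.Finite) ∧
    ∀ i j : ℤ, (c.coeff j).coeff i =
      ({a | deg a = (i, j, 0)}.ncard : ℚ) - ({a | deg a = (i, j, 1)}.ncard : ℚ)

/-- `y` is the image of the class of the projective object `N` in the completed Verma module,
under `[Ω_k] ↦ m_k` and `π ↦ -1`. -/
def IsProjClass (N : CatM.{u}) (y : Verma Ser) : Prop := ∀ k, HasMult (N.comp k) (y k)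

/-- `γ : K0 → M(λq⁻¹)` is the identification with `[Ω_k] ↦ m_k`, at `π = -1`: if
`M_k ≅ ⨁_a Π^{p_a} Ω_k⟨i_a, j_a⟩`, then `[M] ↦ ∑_k (∑_a (-1)^{p_a} q^{i_a} λ^{j_a}) m_k`. -/
def IsK0Map (γ : K0.{u} →+ Verma KL) : Prop :=
  ∀ M : {M : CatM.{u} // IsFgProj M}, ∀ k, HasMult (M.1.comp k) (expand (γ (K0.mk M) k))

/-- `γ : G0 → ℚ((q))((λ)) ⊗ M(λq⁻¹)` is the identification with `[S_k] ↦ m^k = d k`, at `π = -1`,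
factoring through the topological Grothendieck group (classes modulo equality of all composition
multiplicities): the class of `N` is `∑_k c_k m^k`, where `c_k` counts the composition factors
`Π^p S_k⟨i, j⟩` of `N_k` with weights `(-1)^p q^i λ^j`. As the simple object `S_k = ℚ` is
one-dimensional, in degree `0`, the number of these factors is `dim (N_k)_{i,j,p}`. -/
def IsG0Map (d : ℕ → Verma Ser) (γ : G0.{u} →+ Verma Ser) : Prop :=
  ∀ N : CatM.{u}, ∃ c : ℕ →₀ Ser, (∀ k, IsGdim (fun e => (N.comp k).gr e) (c k)) ∧
    γ (G0.mk N) = c.sum fun k a => a • d k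

end VermaCat

end

noncomputable section

namespace VermaCat

/-! ## The bar involution and expansion -/

/-! The theorem rests on one coincidence: the norm of `m k` under the Shapovalov form is the graded
dimension of `Ω_k` at `π = -1`. On the form side, `K` and `K⁻¹` are adjoint and the weights of the
`m i` are distinct, so the basis is orthogonal. Adjointness of `F` with `τ(F)` gives a recursion for
the norms. It forces `⟨m_k, m_k⟩ = ∏_{n=1}^k (1 - λ² q^{-2n}) / (1 - q^{2n})`
(`IsShapovalov.apply_m`), and the diagonal form with these norms is indeed a Shapovalov form
(`shapForm_isShapovalov`). On the algebra side, each `x_n` contributes the geometric series `1 / (1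
- q^{2n})`, and each odd `s_n` the factor `1 - λ² q^{-2n}` (`isCount_monDeg`).

The norm is nonzero in the field `ℚ((q))((λ))`, so `m^k` is `m_k` divided by its norm, and the
`m_k`-coordinate of the class of `N` is the graded dimension of `N_k` divided by that of `Ω_k`.
Every statement about classes thus becomes the equation "graded dimension = norm times coordinate"
(`isK0Map_iff`, `isG0Map_iff`). Existence of the maps on `K0` and `G0` is then additivity of graded
dimensions (`SMod.gdim_of_exact`), and uniqueness is cancellation of the norm.

For projectives one needs that they are graded free (`exists_homogeneous_basis`). The weight `i +
(k+1)j` is positive on all generators of `Ω_k`, so graded Nakayama applies. Lifts of a homogeneous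
basis modulo the augmentation ideal generate, and a splitting of the resulting presentation confines
its kernel to all powers of a separated filtration, hence makes it zero.

Finally, a homogeneous map out of a graded free module is an arbitrary choice of images of the
basis, so a generator of degree `(i, j, p)` contributes `(-1)^p q^{-i} λ^{-j}` times the graded
dimension of `N_k`. The inverted exponents are the bar involution in the first slot of the form, and
summing over `k` gives the pairing (`hom_pairing`). -/

lemma bar_C (a : Kq) : bar (LaurentPolynomial.C a) = LaurentPolynomial.C (barK a) := by
  rw [bar, LaurentPolynomial.eval₂_C]; rfl

lemma lamUnit_zpow (n : ℤ) : ((lamUnit ^ n : KLˣ) : KL) = LaurentPolynomial.T n := by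
  have key : ∀ n : ℕ, ((lamUnit ^ n : KLˣ) : KL) = LaurentPolynomial.T n := by
    intro n
    rw [Units.val_pow_eq_pow_val]
    simp [lamUnit, LaurentPolynomial.T_pow]
  obtain ⟨n, rfl | rfl⟩ := n.eq_nat_or_neg
  · rw [zpow_natCast, key]
  · rw [zpow_neg, zpow_natCast]
    apply (lamUnit ^ n).isUnit.mul_left_cancel
    rw [Units.mul_inv, key, ← LaurentPolynomial.T_add]
    simp

lemma bar_T (n : ℤ) : bar (LaurentPolynomial.T n) = LaurentPolynomial.T (-n) := by
  rw [bar, LaurentPolynomial.eval₂_T, inv_zpow', lamUnit_zpow]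

lemma barK_zpow (n : ℤ) : barK (q ^ n) = q ^ (-n) := by
  rw [map_zpow₀, barK_q, inv_zpow']

/-- Numerator and denominator both change sign under the bar involution. -/
lemma bar_lamint (n : ℤ) : bar (lamint n) = lamint n := by
  have h : (q⁻¹ - q) = -(q - q⁻¹) := by ring
  simp only [lamint, map_sub, map_mul, bar_C, bar_T, map_div₀, barK_zpow, map_inv₀, barK_q,
    inv_inv, neg_neg, h, div_neg, map_neg]
  ring

lemma expand_C (a : Kq) : expand (LaurentPolynomial.C a) = HahnSeries.C (expandK a) := by
  rw [expand, LaurentPolynomial.eval₂_C]; rfl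

lemma serLam_zpow (n : ℤ) : ((serLam ^ n : Serˣ) : Ser) = HahnSeries.single n 1 := by
  have key : ∀ n : ℕ, ((serLam ^ n : Serˣ) : Ser) = HahnSeries.single (n : ℤ) 1 := by
    intro n
    rw [Units.val_pow_eq_pow_val]
    simp [serLam, HahnSeries.single_pow]
  obtain ⟨n, rfl | rfl⟩ := n.eq_nat_or_neg
  · rw [zpow_natCast, key]
  · rw [zpow_neg, zpow_natCast]
    apply (serLam ^ n).isUnit.mul_left_cancel
    rw [Units.mul_inv, key, HahnSeries.single_mul_single]
    simp

lemma expand_T (n : ℤ) : expand (LaurentPolynomial.T n) = HahnSeries.single n 1 := by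
  rw [expand, LaurentPolynomial.eval₂_T, serLam_zpow]

lemma expandK_q : expandK q = HahnSeries.single 1 1 := by
  exact RatFunc.coe_X

lemma expandK_zpow (n : ℤ) : expandK (q ^ n) = HahnSeries.single n 1 := by
  rw [map_zpow₀, expandK_q]
  exact (RatFunc.single_zpow n).symm

lemma expand_monomial (i j : ℤ) :
    expand (LaurentPolynomial.C (q ^ i) * LaurentPolynomial.T j) =
      HahnSeries.single j (HahnSeries.single i 1) := by
  rw [map_mul, expand_C, expand_T, expandK_zpow, HahnSeries.C_apply, HahnSeries.single_mul_single]
  simp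

/-- Expansion only touches the coefficients in `ℚ(q)`, so injectivity of `expand` reduces to that of
a field embedding. -/
lemma coeff_expand (f : KL) (n : ℤ) : (expand f).coeff n = expandK (f.coeff n) := by
  induction f using LaurentPolynomial.induction_on' with
  | add f g hf hg => simp [hf, hg]
  | C_mul_T j a =>
    rw [map_mul, expand_C, expand_T, HahnSeries.C_apply, HahnSeries.single_mul_single, zero_add,
      mul_one, ← LaurentPolynomial.single_eq_C_mul_T]
    by_cases h : n = j
    · subst h
      rw [HahnSeries.coeff_single_same, AddMonoidAlgebra.coeff_single, Finsupp.single_eq_same]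
    · rw [HahnSeries.coeff_single_of_ne h, AddMonoidAlgebra.coeff_single,
        Finsupp.single_eq_of_ne h, map_zero]

lemma expand_injective : Function.Injective expand := by
  intro f g h
  apply LaurentPolynomial.ext
  intro n
  apply expandK.injective
  rw [← coeff_expand, ← coeff_expand, h]

/-! ## The universal Shapovalov form -/

/-- The norm `∏_{n=1}^k (1 - λ² q^{-2n}) / (1 - q^{2n})` of `m_k`. -/
def shapCoef (k : ℕ) : KL := ∏ n ∈ Finset.range k,
  (LaurentPolynomial.C (1 - q ^ (2 * ((n : ℤ) + 1)))⁻¹ *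
    (1 - LaurentPolynomial.C (q ^ (-(2 * ((n : ℤ) + 1)))) * LaurentPolynomial.T 2))

lemma shapCoef_zero : shapCoef 0 = 1 := by simp [shapCoef]

lemma shapCoef_succ (k : ℕ) : shapCoef (k + 1) = shapCoef k *
    (LaurentPolynomial.C (1 - q ^ (2 * ((k : ℤ) + 1)))⁻¹ *
    (1 - LaurentPolynomial.C (q ^ (-(2 * ((k : ℤ) + 1)))) * LaurentPolynomial.T 2)) :=
  Finset.prod_range_succ _ _

lemma q_zpow_ne_one {n : ℤ} (hn : n ≠ 0) : q ^ n ≠ 1 := by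
  intro h
  have h1 := congrArg expandK h
  rw [expandK_zpow, RingHom.map_one] at h1
  have h2 := congrArg (fun s : LaurentSeries ℚ => s.coeff 0) h1
  rw [HahnSeries.coeff_single_of_ne (Ne.symm hn), HahnSeries.coeff_one, if_pos rfl] at h2
  exact zero_ne_one h2

lemma one_sub_q_ne_zero (k : ℕ) : (1 : Kq) - q ^ (2 * ((k : ℤ) + 1)) ≠ 0 :=
  sub_ne_zero.2 (q_zpow_ne_one (by positivity)).symm

lemma shapCoef_ne_zero (k : ℕ) : shapCoef k ≠ 0 := by
  refine Finset.prod_ne_zero_iff.2 fun n _ => mul_ne_zero ?_ ?_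
  · rw [Ne, map_eq_zero_iff _ (LaurentPolynomial.C (R := Kq)).injective]
    exact inv_ne_zero (one_sub_q_ne_zero n)
  · intro h
    -- The coefficient of `λ^0` in `1 - q^{-2(n+1)} λ²` is `1`, so this factor cannot vanish.
    have h2 : (LaurentPolynomial.C (q ^ (-(2 * ((n : ℤ) + 1)))) * LaurentPolynomial.T 2 : KL).coeff 0
        = 0 := by
      rw [← LaurentPolynomial.single_eq_C_mul_T, AddMonoidAlgebra.coeff_single,
        Finsupp.single_eq_of_ne (by norm_num)]
    have h3 : (1 : KL).coeff 0 = 1 := by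
      rw [← LaurentPolynomial.T_zero, LaurentPolynomial.T_apply, if_pos rfl]
    have h4 := (AddMonoidAlgebra.coeff_sub (1 : KL) (LaurentPolynomial.C (q ^ (-(2 * ((n : ℤ) + 1)))) *
      LaurentPolynomial.T 2))
    rw [h] at h4
    have h5 := DFunLike.congr_fun h4 0
    rw [Finsupp.sub_apply, h2, h3] at h5
    simp at h5

lemma qint_ne_zero (k : ℕ) : qint ((k : ℤ) + 1) ≠ 0 := by
  refine div_ne_zero ?_ q_sub_inv_ne_zero
  intro h
  have : q ^ (2 * ((k : ℤ) + 1)) = 1 := by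
    rw [two_mul, zpow_add₀ q_ne_zero]
    nth_rewrite 1 [sub_eq_zero.1 h]
    rw [← zpow_add₀ q_ne_zero]
    simp
  exact one_sub_q_ne_zero k (by rw [this, sub_self])

/-- The recursion for the norms in terms of the action of `E` and `F`. -/
lemma qint_mul_shapCoef_succ (k : ℕ) :
    LaurentPolynomial.C (qint ((k : ℤ) + 1)) * shapCoef (k + 1) =
      LaurentPolynomial.C (q ^ (-(2 * ((k : ℤ) + 1)))) * LaurentPolynomial.T 1 *
        lamint (-((k : ℤ) + 1)) * shapCoef k := by
  rw [shapCoef_succ, lamint, neg_neg]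
  have hq := q_ne_zero
  have hx : q ^ ((k : ℤ) + 1) ≠ 0 := zpow_ne_zero _ hq
  have hd := q_sub_inv_ne_zero
  have h0 := one_sub_q_ne_zero k
  rw [show 2 * ((k : ℤ) + 1) = ((k : ℤ) + 1) + ((k : ℤ) + 1) by ring, zpow_add₀ hq] at h0
  -- With `n = k + 1`, the quotient `[n] / (1 - q^{2n})` collapses to `-q^{-n} / (q - q⁻¹)`, which
  -- turns the new factor of the product into `λ q^{-2n} [λ, -n]`.
  have e1 : qint ((k : ℤ) + 1) * (1 - q ^ (2 * ((k : ℤ) + 1)))⁻¹ =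
      -(q ^ (-((k : ℤ) + 1)) / (q - q⁻¹)) := by
    rw [qint, show 2 * ((k : ℤ) + 1) = ((k : ℤ) + 1) + ((k : ℤ) + 1) by ring,
      zpow_add₀ hq ((k : ℤ) + 1) ((k : ℤ) + 1), zpow_neg]
    generalize q ^ ((k : ℤ) + 1) = x at *
    generalize q - q⁻¹ = d at *
    rw [← div_eq_mul_inv, div_eq_iff h0]
    field_simp
    ring
  have e2 : q ^ (-(2 * ((k : ℤ) + 1))) * (q ^ (((k : ℤ) + 1)) / (q - q⁻¹)) =
      q ^ (-((k : ℤ) + 1)) / (q - q⁻¹) := by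
    rw [mul_div_assoc', ← zpow_add₀ hq]
    congr 2; ring
  have e3 := congrArg (LaurentPolynomial.C (R := Kq)) e1
  have e4 := congrArg (LaurentPolynomial.C (R := Kq)) e2
  have t0 : (LaurentPolynomial.T 1 * LaurentPolynomial.T (-1) : KL) = 1 := by
    rw [← LaurentPolynomial.T_add]; simp
  have t1 : (LaurentPolynomial.T 2 : KL) = LaurentPolynomial.T 1 * LaurentPolynomial.T 1 := by
    rw [← LaurentPolynomial.T_add]; simp
  rw [map_mul, map_neg] at e3
  rw [map_mul] at e4
  rw [t1]
  linear_combination shapCoef k * (1 - LaurentPolynomial.C (q ^ (-(2 * ((k : ℤ) + 1)))) *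
    (LaurentPolynomial.T 1 * LaurentPolynomial.T 1)) * e3 +
    shapCoef k * LaurentPolynomial.T 1 * LaurentPolynomial.T (-1) * e4 +
    shapCoef k * LaurentPolynomial.C (q ^ (-((k : ℤ) + 1)) / (q - q⁻¹)) * t0

/-- Sesquilinear forms on the universal Verma module. -/
abbrev Form : Type := Verma KL →ₛₗ[bar] Verma KL →ₗ[KL] KL

lemma form_ext {B B' : Form} (h : ∀ i j, B (m i) (m j) = B' (m i) (m j)) : B = B' := by
  have e : ∀ i (c : KL), (Finsupp.single i c : Verma KL) = c • m i := fun i c => by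
    rw [Finsupp.smul_single, smul_eq_mul, mul_one]
  refine LinearMap.ext fun x => LinearMap.ext fun y => ?_
  induction x using Finsupp.induction_linear with
  | zero => simp
  | add x x' hx hx' => simp only [map_add, LinearMap.add_apply, hx, hx']
  | single i a =>
    induction y using Finsupp.induction_linear with
    | zero => simp
    | add y y' hy hy' => simp only [map_add, hy, hy']
    | single j b =>
      rw [e, e]
      simp only [map_smul, map_smulₛₗ, LinearMap.smul_apply, h]

/-- The diagonal form with the norms `shapCoef`. -/
def shapForm : Form :=
  LinearMap.mk₂'ₛₗ bar (RingHom.id KL)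
    (fun x y => x.sum fun i a => bar a * (y i * shapCoef i))
    (fun x x' y => Finsupp.sum_add_index' (by simp) (by intros; rw [map_add, add_mul]))
    (fun c x y => by
      rw [Finsupp.sum_smul_index (by simp), smul_eq_mul, Finsupp.mul_sum]
      simp only [map_mul, mul_assoc])
    (fun x y y' => by
      simp only [Finsupp.add_apply, add_mul, mul_add, Finsupp.sum_add])
    (fun c x y => by
      simp only [Finsupp.smul_apply, smul_eq_mul, RingHom.id_apply, Finsupp.mul_sum]
      refine Finset.sum_congr rfl fun i _ => ?_
      ring)

lemma shapForm_m (i j : ℕ) : shapForm (m i) (m j) = if i = j then shapCoef i else 0 := by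
  refine (Finsupp.sum_single_index
    (h := fun i' (a : KL) => bar a * ((m j : Verma KL) i' * shapCoef i'))
    (by rw [map_zero, zero_mul])).trans ?_
  by_cases h : i = j
  · subst h; simp
  · simp [h]

/-! ### Adjointness -/

lemma tau_add (a b : Uq) : tau (a + b) = tau a + tau b := by simp [tau]

lemma tau_mul (a b : Uq) : tau (a * b) = tau b * tau a := by simp [tau]

lemma tau_algebraMap (c : Kq) : tau (algebraMap Kq Uq c) = algebraMap Kq Uq (barK c) := by
  rw [← (RingQuot.mkAlgHom Kq Rel).commutes, tau, ← AlgHom.coe_toRingHom, RingQuot.mkAlgHom_coe,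
    RingQuot.lift_mkRingHom_apply, tauFree_algebraMap]

lemma act_algebraMap (c : Kq) (x : Verma KL) :
    act (algebraMap Kq Uq c) x = (LaurentPolynomial.C c : KL) • x := by
  rw [AlgHom.commutes, ← Kq_smul]
  rfl

/-- Adjointness has to be checked only for the generators. -/
lemma adj_of_gen {B : Form}
    (h : ∀ (g : Gen) (x y : Verma KL), B (act (u g) x) y = B x (act (tau (u g)) y))
    (a : Uq) (x y : Verma KL) : B (act a x) y = B x (act (tau a) y) := by
  obtain ⟨a, rfl⟩ := RingQuot.mkAlgHom_surjective Kq Rel a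
  induction a using FreeAlgebra.induction generalizing x y with
  | grade0 c =>
    -- Antilinearity of `τ` matches antilinearity of the form in its first variable.
    rw [AlgHom.commutes, tau_algebraMap, act_algebraMap, act_algebraMap, map_smulₛₗ,
      LinearMap.smul_apply, map_smul, bar_C]
  | grade1 g => exact h g x y
  | mul a b ha hb =>
    rw [map_mul, map_mul, tau_mul, map_mul, Module.End.mul_apply, Module.End.mul_apply, ha, hb]
  | add a b ha hb =>
    rw [map_add, map_add, tau_add, map_add, LinearMap.add_apply, LinearMap.add_apply, map_add,
      map_add, LinearMap.add_apply, ha, hb]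

/-- Both sides are sesquilinear forms in `x` and `y`, because the action of `a` is linear over
`ℚ(q)[λ, λ⁻¹]`. -/
lemma adj_of_basis {B : Form} {a : Uq}
    (h : ∀ i j, B (act a (m i)) (m j) = B (m i) (act (tau a) (m j))) (x y : Verma KL) :
    B (act a x) y = B x (act (tau a) y) := by
  let B1 : Form := B.comp (act a)
  let B2 : Form := B.compl₂ (act (tau a))
  have : B1 = B2 := form_ext h
  exact LinearMap.congr_fun₂ this x y

lemma act_smul_apply (c : Kq) (a : Uq) (x : Verma KL) :
    act (c • a) x = (LaurentPolynomial.C c : KL) • act a x := by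
  rw [map_smul, LinearMap.smul_apply, Kq_smul]

lemma act_tauE_m (i : ℕ) : act (tau (u .E)) (m i) =
    (LaurentPolynomial.C (q ^ (2 * ((i : ℤ) + 1))) * LaurentPolynomial.T (-1) *
      LaurentPolynomial.C (qint ((i : ℤ) + 1)) : KL) • m (i + 1) := by
  rw [tau_u, tauGen, act_smul_apply, map_mul, Module.End.mul_apply, act_u, act_u, actF_m, map_smul,
    actKinv_m, smul_smul, smul_smul]
  congr 1
  have : q⁻¹ * q ^ (1 + 2 * ((i + 1 : ℕ) : ℤ)) = q ^ (2 * ((i : ℤ) + 1)) := by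
    rw [← zpow_neg_one, ← zpow_add₀ q_ne_zero]; congr 1; push_cast; ring
  rw [← this, map_mul]
  ring

lemma act_tauF_m_zero : act (tau (u .F)) (m 0) = 0 := by
  rw [tau_u, tauGen, act_smul_apply, map_mul, Module.End.mul_apply, act_u, act_u, actE_m_zero,
    map_zero, smul_zero]

lemma act_tauF_m_succ (i : ℕ) : act (tau (u .F)) (m (i + 1)) =
    (LaurentPolynomial.C (q ^ (-(2 * ((i : ℤ) + 1)))) * LaurentPolynomial.T 1 *
      lamint (-((i : ℤ) + 1)) : KL) • m i := by
  rw [tau_u, tauGen, act_smul_apply, map_mul, Module.End.mul_apply, act_u, act_u, actE_m_succ,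
    map_smul, actK_m, smul_smul, smul_smul]
  congr 1
  have : q⁻¹ * q ^ (-1 - 2 * (i : ℤ)) = q ^ (-(2 * ((i : ℤ) + 1))) := by
    rw [← zpow_neg_one, ← zpow_add₀ q_ne_zero]; congr 1; ring
  rw [← this, map_mul]
  ring

/-- Off the relevant diagonal both sides vanish. On it, the `E` and `F` cases are the same recursion
`qint_mul_shapCoef_succ`, up to the unit `q^{2(i+1)} λ⁻¹`, and the `K` cases say that the bar
involution inverts weights. -/
lemma shapForm_isShapovalov : IsShapovalov shapForm := by
  refine ⟨by rw [shapForm_m, if_pos rfl, shapCoef_zero], adj_of_gen fun g => adj_of_basis ?_⟩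
  intro i j
  cases g with
  | E =>
    rw [act_tauE_m, map_smul, shapForm_m, smul_eq_mul, act_u]
    cases i with
    | zero => rw [actE_m_zero, if_neg (by omega)]; simp
    | succ i =>
      rw [actE_m_succ, map_smulₛₗ, LinearMap.smul_apply, shapForm_m, bar_lamint, smul_eq_mul]
      by_cases h : i = j
      · subst h
        rw [if_pos rfl, if_pos rfl, mul_assoc, qint_mul_shapCoef_succ]
        have e1 := C_T_mul (q ^ (2 * ((i : ℤ) + 1))) (q ^ (-(2 * ((i : ℤ) + 1)))) (-1) 1
        rw [← zpow_add₀ q_ne_zero] at e1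
        simp only [add_neg_cancel, zpow_zero, neg_add_cancel, LaurentPolynomial.T_zero, map_one,
          mul_one] at e1
        linear_combination (-lamint (-((i : ℤ) + 1)) * shapCoef i) * e1
      · rw [if_neg h, if_neg (by omega)]; simp
  | F =>
    rw [act_u, actF_m, map_smulₛₗ, LinearMap.smul_apply, shapForm_m]
    cases j with
    | zero => rw [act_tauF_m_zero, if_neg (by omega)]; simp
    | succ j =>
      rw [act_tauF_m_succ, map_smul, shapForm_m, smul_eq_mul, smul_eq_mul]
      by_cases h : i = j
      · subst h
        rw [if_pos rfl, if_pos rfl, ← qint_mul_shapCoef_succ]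
        congr 1
        rw [bar_C]
        congr 1
        have h : (q⁻¹ - q) = -(q - q⁻¹) := by ring
        simp only [qint, map_div₀, map_sub, barK_zpow, map_inv₀, barK_q, inv_inv, neg_neg, h]
        rw [div_neg, ← neg_div, neg_sub]
      · rw [if_neg h, if_neg (by omega)]; simp
  | K =>
    rw [tau_u, tauGen, act_u, act_u, actK_m, actKinv_m, map_smulₛₗ, LinearMap.smul_apply, map_smul,
      shapForm_m, map_mul, bar_C, bar_T, barK_zpow]
    by_cases h : i = j
    · subst h; congr 4; ring
    · rw [if_neg h]; simp
  | Kinv =>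
    rw [tau_u, tauGen, act_u, act_u, actK_m, actKinv_m, map_smulₛₗ, LinearMap.smul_apply, map_smul,
      shapForm_m, map_mul, bar_C, bar_T, barK_zpow]
    by_cases h : i = j
    · subst h; congr 4; ring
    · rw [if_neg h]; simp

/-- Moving `K⁻¹` across the form multiplies the value by `λ q^{-1-2i}` on one side and `λ q^{-1-2j}`
on the other. The difference is nonzero in a domain because `q` is not a root of unity. -/
lemma IsShapovalov.apply_ne {B : Form} (hB : IsShapovalov B) {i j : ℕ} (h : i ≠ j) :
    B (m i) (m j) = 0 := by
  have h1 := hB.adj (u .Kinv) (m i) (m j)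
  rw [tau_u, tauGen, act_u, act_u, actK_m, actKinv_m, map_smulₛₗ, LinearMap.smul_apply, map_smul,
    map_mul, bar_C, bar_T, barK_zpow, ← sub_eq_zero, ← sub_smul, smul_eq_mul, neg_neg, ← sub_mul,
    ← map_sub] at h1
  rcases mul_eq_zero.1 h1 with h2 | h2
  · exfalso
    rcases mul_eq_zero.1 h2 with h3 | h3
    · rw [map_eq_zero_iff _ (LaurentPolynomial.C (R := Kq)).injective, sub_eq_zero] at h3
      refine q_zpow_ne_one (n := 2 * ((j : ℤ) - i)) (by omega) ?_
      rw [show 2 * ((j : ℤ) - i) = -(1 + 2 * (i : ℤ)) - (-1 - 2 * (j : ℤ)) by ring,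
        zpow_sub₀ q_ne_zero, h3, div_self (zpow_ne_zero _ q_ne_zero)]
    · exact (LaurentPolynomial.isUnit_T (R := Kq) 1).ne_zero h3
  · exact h2

/-- The adjunction for `F` determines each norm from the preceding one, since `[k+1] ≠ 0`. Comparing
with `shapForm`, which obeys the same relation, avoids solving the recursion again. -/
lemma IsShapovalov.apply_self {B : Form} (hB : IsShapovalov B) (k : ℕ) :
    B (m k) (m k) = shapCoef k := by
  induction k with
  | zero => rw [hB.one, shapCoef_zero]
  | succ k ih =>
    have h1 := hB.adj (u .F) (m k) (m (k + 1))
    have h2 := shapForm_isShapovalov.adj (u .F) (m k) (m (k + 1))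
    rw [act_tauF_m_succ, map_smul, act_u, actF_m, map_smulₛₗ, LinearMap.smul_apply] at h1 h2
    rw [ih] at h1
    rw [shapForm_m, shapForm_m, if_pos rfl, if_pos rfl, ← h1, bar_C] at h2
    rw [smul_eq_mul, smul_eq_mul] at h2
    refine (mul_left_cancel₀ ?_ h2).symm
    rw [Ne, map_eq_zero_iff _ (LaurentPolynomial.C (R := Kq)).injective, map_eq_zero_iff _ barK.injective]
    exact qint_ne_zero k

lemma IsShapovalov.apply_m {B : Form} (hB : IsShapovalov B) (i j : ℕ) :
    B (m i) (m j) = if i = j then shapCoef i else 0 := by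
  split_ifs with h
  · subst h; exact hB.apply_self i
  · exact hB.apply_ne h

theorem existsUnique_shapovalov : ∃! B : Form, IsShapovalov B :=
  ⟨shapForm, shapForm_isShapovalov, fun B hB => form_ext fun i j => by
    rw [hB.apply_m, shapForm_m]⟩

/-! ### The dual canonical basis -/

lemma expand_shapCoef_ne_zero (k : ℕ) : expand (shapCoef k) ≠ 0 := by
  rw [Ne, map_eq_zero_iff _ expand_injective]
  exact shapCoef_ne_zero k

/-- The form is diagonal, so only the `j`-th coordinate of `x` meets the `j`-th coordinate of `y`.
-/
lemma IsShapovalov.extend_eq {B : Form} (hB : IsShapovalov B) (x : Verma KL) (y : Verma Ser) :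
    extend B x y = y.sum fun j c => c * (expand (bar (x j)) * expand (shapCoef j)) := by
  refine Finset.sum_congr rfl fun j _ => ?_
  dsimp only
  rw [← map_mul]
  congr 2
  induction x using Finsupp.induction_linear with
  | zero => simp
  | add x x' hx hx' => rw [map_add, LinearMap.add_apply, hx, hx', Finsupp.add_apply, map_add, add_mul]
  | single i c =>
    have e : (Finsupp.single i c : Verma KL) = c • m i := by
      rw [Finsupp.smul_single, smul_eq_mul, mul_one]
    rw [e, map_smulₛₗ, LinearMap.smul_apply, hB.apply_m, smul_eq_mul]
    by_cases h : i = j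
    · subst h; simp
    · simp [h]

lemma IsShapovalov.extend_m {B : Form} (hB : IsShapovalov B) (i : ℕ) (y : Verma Ser) :
    extend B (m i) y = y i * expand (shapCoef i) := by
  rw [hB.extend_eq, Finsupp.sum, Finset.sum_eq_single i]
  · simp
  · intro j _ hj
    simp [hj.symm]
  · intro hi
    simp [Finsupp.notMem_support_iff.1 hi]

lemma IsShapovalov.isDualCanonical_iff {B : Form} (hB : IsShapovalov B) (d : ℕ → Verma Ser) :
    IsDualCanonical B d ↔ d = fun j => Finsupp.single j (expand (shapCoef j))⁻¹ := by
  constructor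
  · intro h
    funext j
    ext1 i
    have := h i j
    rw [hB.extend_m] at this
    rw [eq_div_of_mul_eq (G₀ := Ser) (expand_shapCoef_ne_zero i) this]
    by_cases hij : i = j
    · subst hij
      rw [if_pos rfl, Finsupp.single_eq_same]
      exact one_div (G := Ser) _
    · simp [hij]
  · rintro rfl i j
    rw [hB.extend_m]
    by_cases hij : i = j
    · subst hij
      rw [if_pos rfl, Finsupp.single_eq_same]
      exact inv_mul_cancel₀ (G₀ := Ser) (expand_shapCoef_ne_zero i)
    · simp [hij]

/-! ## Graded counting -/

/-- The sign `(-1)^p`. -/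
def sgn (p : ZMod 2) : ℚ := if p = 0 then 1 else -1

lemma sgn_zero : sgn 0 = 1 := if_pos rfl
lemma sgn_one : sgn 1 = -1 := if_neg (by decide)

lemma sgn_add (p p' : ZMod 2) : sgn (p + p') = sgn p * sgn p' := by
  revert p p'
  have h : ∀ p : ZMod 2, p = 0 ∨ p = 1 := by decide
  intro p p'
  rcases h p with rfl | rfl <;> rcases h p' with rfl | rfl <;>
    simp [sgn_zero, sgn_one, show (1 + 1 : ZMod 2) = 0 by decide]

/-- The monomial `q^i λ^j`. -/
def qlam (i j : ℤ) : Ser := HahnSeries.single j (HahnSeries.single i 1)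

lemma ser_ext {c c' : Ser} (h : ∀ i j, (c.coeff j).coeff i = (c'.coeff j).coeff i) : c = c' :=
  HahnSeries.ext (funext fun j => HahnSeries.ext (funext fun i => h i j))

lemma exists_ser {f : ℤ → ℤ → ℚ} {a b : ℤ} (h : ∀ i j, i < a ∨ j < b → f i j = 0) :
    ∃ c : Ser, ∀ i j, (c.coeff j).coeff i = f i j := by
  refine ⟨HahnSeries.ofSuppBddBelow (fun j => HahnSeries.ofSuppBddBelow (fun i => f i j)
    ⟨a, fun i hi => ?_⟩) ⟨b, fun j hj => ?_⟩, fun i j => rfl⟩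
  · by_contra hlt
    exact hi (h i j (Or.inl (not_le.1 hlt)))
  · by_contra hlt
    refine hj (HahnSeries.ext (funext fun i => ?_))
    exact h i j (Or.inr (not_le.1 hlt))

/-- Replacing the antidiagonal of the supports by an interval that depends only on lower bounds lets
the nested `λ`- and `q`-sums be merged into one product index set. -/
lemma coeff_mul_eq_sum_Icc {R : Type*} [CommRing R] {x y : LaurentSeries R} {a b : ℤ}
    (hx : ∀ i < a, x.coeff i = 0) (hy : ∀ i < b, y.coeff i = 0) (n : ℤ) :
    (x * y).coeff n = ∑ l ∈ Finset.Icc a (n - b), x.coeff l * y.coeff (n - l) := by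
  rw [HahnSeries.coeff_mul]
  refine Finset.sum_of_injOn (fun ij => ij.1) ?_ ?_ ?_ ?_
  · intro s hs t ht h
    simp only [Finset.mem_coe, Finset.mem_antidiagonal] at hs ht
    dsimp only at h
    exact Prod.ext h (by omega)
  · intro s hs
    simp only [Finset.mem_coe, Finset.mem_antidiagonal, HahnSeries.mem_support] at hs
    have h1 : ¬ s.1 < a := fun h => hs.1 (hx _ h)
    have h2 : ¬ s.2 < b := fun h => hs.2.1 (hy _ h)
    simp only [Finset.mem_coe, Finset.mem_Icc]
    omega
  · intro l _ hl
    by_contra hne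
    refine hl ⟨(l, n - l), ?_, rfl⟩
    simp only [Finset.mem_coe, Finset.mem_antidiagonal, HahnSeries.mem_support]
    exact ⟨left_ne_zero_of_mul hne, right_ne_zero_of_mul hne, by ring⟩
  · intro s hs
    simp only [Finset.mem_antidiagonal] at hs
    rw [← hs.2.2, add_sub_cancel_left]

/-- `c` is the signed generating function of a locally finite set graded by `deg`, bounded from
below. -/
structure IsCount {X : Type*} (deg : X → Deg) (c : Ser) : Prop where
  bdd : ∃ a b : ℤ, ∀ x, a ≤ (deg x).1 ∧ b ≤ (deg x).2.1
  fin : ∀ i j, {x | (deg x).1 = i ∧ (deg x).2.1 = j}.Finite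
  coeff : ∀ i j, (c.coeff j).coeff i = ∑ x ∈ (fin i j).toFinset, sgn (deg x).2.2

namespace IsCount

variable {X Y : Type*} {deg : X → Deg} {deg' : Y → Deg} {c c' : Ser}

lemma unique {c c' : Ser} (h : IsCount deg c) (h' : IsCount deg c') : c = c' :=
  ser_ext fun i j => by rw [h.coeff, h'.coeff]

lemma exists_of (bdd : ∃ a b : ℤ, ∀ x, a ≤ (deg x).1 ∧ b ≤ (deg x).2.1)
    (fin : ∀ i j, {x | (deg x).1 = i ∧ (deg x).2.1 = j}.Finite) : ∃ c, IsCount deg c := by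
  obtain ⟨a, b, hab⟩ := bdd
  obtain ⟨c, hc⟩ := exists_ser (f := fun i j => ∑ x ∈ (fin i j).toFinset, sgn (deg x).2.2)
    (a := a) (b := b) (fun i j hij => by
      refine Finset.sum_eq_zero fun x hx => ?_
      simp only [Set.Finite.mem_toFinset, Set.mem_ofPred_eq] at hx
      have := hab x
      omega)
  exact ⟨c, ⟨a, b, hab⟩, fin, hc⟩

lemma coeff_eq_zero (h : IsCount deg c) {a b : ℤ} (hab : ∀ x, a ≤ (deg x).1 ∧ b ≤ (deg x).2.1)
    {i j : ℤ} (hij : i < a ∨ j < b) : (c.coeff j).coeff i = 0 := by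
  rw [h.coeff]
  refine Finset.sum_eq_zero fun x hx => ?_
  simp only [Set.Finite.mem_toFinset, Set.mem_ofPred_eq] at hx
  have := hab x
  omega

lemma finite_le (h : IsCount deg c) (i j : ℤ) : {x | (deg x).1 ≤ i ∧ (deg x).2.1 ≤ j}.Finite := by
  obtain ⟨a, b, hab⟩ := h.bdd
  refine Set.Finite.subset (Set.Finite.biUnion (Set.finite_Icc a i) fun i' _ =>
    Set.Finite.biUnion (Set.finite_Icc b j) fun j' _ => h.fin i' j') ?_
  intro x hx
  simp only [Set.mem_iUnion]
  exact ⟨_, ⟨(hab x).1, hx.1⟩, _, ⟨(hab x).2, hx.2⟩, rfl, rfl⟩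

lemma comp_equiv (h : IsCount deg c) (e : Y ≃ X) : IsCount (fun y => deg (e y)) c where
  bdd := by
    obtain ⟨a, b, hab⟩ := h.bdd
    exact ⟨a, b, fun y => hab (e y)⟩
  fin i j := (h.fin i j).preimage e.injective.injOn
  coeff i j := by
    rw [h.coeff]
    refine (Finset.sum_equiv e (fun y => ?_) fun y _ => rfl).symm
    simp

lemma congr (h : IsCount deg c) {deg₁ : X → Deg} (e : ∀ x, deg₁ x = deg x) : IsCount deg₁ c := by
  rwa [show deg₁ = deg from funext e]

/-- The lower bounds on one factor bound the degree of the other from above once the total degree is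
fixed. This gives finiteness, and makes the convolution a finite sum. -/
lemma mul (h : IsCount deg c) (h' : IsCount deg' c') :
    IsCount (fun z : X × Y => deg z.1 + deg' z.2) (c * c') := by
  obtain ⟨a, b, hab⟩ := h.bdd
  obtain ⟨a', b', hab'⟩ := h'.bdd
  have fin : ∀ i j, {z : X × Y | (deg z.1 + deg' z.2).1 = i ∧ (deg z.1 + deg' z.2).2.1 = j}.Finite := by
    intro i j
    refine ((h.finite_le (i - a') (j - b')).prod (h'.finite_le (i - a) (j - b))).subset ?_
    rintro ⟨x, y⟩ hz
    have h1 := hab x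
    have h2 := hab' y
    simp only [Set.mem_ofPred_eq, Prod.fst_add, Prod.snd_add, Set.mem_prod] at hz ⊢
    omega
  refine ⟨⟨a + a', b + b', fun z => ?_⟩, fin, fun i j => ?_⟩
  · have h1 := hab z.1
    have h2 := hab' z.2
    simp only [Prod.fst_add, Prod.snd_add]
    omega
  rw [coeff_mul_eq_sum_Icc (a := b) (b := b')
    (fun j hj => HahnSeries.ext (funext fun i => h.coeff_eq_zero hab (Or.inr hj)))
    (fun j hj => HahnSeries.ext (funext fun i => h'.coeff_eq_zero hab' (Or.inr hj))),
    HahnSeries.coeff_sum]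
  have key : ∀ j₁, (c.coeff j₁ * c'.coeff (j - j₁)).coeff i =
      ∑ i₁ ∈ Finset.Icc a (i - a'), (c.coeff j₁).coeff i₁ * (c'.coeff (j - j₁)).coeff (i - i₁) :=
    fun j₁ => coeff_mul_eq_sum_Icc (fun i hi => h.coeff_eq_zero hab (Or.inl hi))
      (fun i hi => h'.coeff_eq_zero hab' (Or.inl hi)) i
  simp only [key]
  rw [← Finset.sum_product']
  -- Pairs of total degree `(i, j)` are sorted by the degree of their first entry.
  rw [← Finset.sum_fiberwise_of_maps_to (s := (fin i j).toFinset)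
    (t := Finset.Icc b (j - b') ×ˢ Finset.Icc a (i - a'))
    (g := fun z => ((deg z.1).2.1, (deg z.1).1))]
  · refine Finset.sum_congr rfl fun w _ => ?_
    rw [h.coeff, h'.coeff, Finset.sum_mul_sum, ← Finset.sum_product']
    refine Finset.sum_congr ?_ fun z _ => ?_
    · ext z
      simp only [Finset.mem_product, Set.Finite.mem_toFinset, Set.mem_ofPred_eq, Finset.mem_filter,
        Prod.fst_add, Prod.snd_add, Prod.ext_iff]
      omega
    · simp only [Prod.snd_add, sgn_add]
  · intro z hz
    have h1 := hab z.1
    have h2 := hab' z.2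
    simp only [Set.Finite.mem_toFinset, Set.mem_ofPred_eq, Prod.fst_add, Prod.snd_add,
      Finset.mem_product, Finset.mem_Icc] at hz ⊢
    omega

lemma sum (h : IsCount deg c) (h' : IsCount deg' c') : IsCount (Sum.elim deg deg') (c + c') := by
  obtain ⟨a, b, hab⟩ := h.bdd
  obtain ⟨a', b', hab'⟩ := h'.bdd
  have fin : ∀ i j, {z | (Sum.elim deg deg' z).1 = i ∧ (Sum.elim deg deg' z).2.1 = j}.Finite := by
    intro i j
    refine (((h.fin i j).image Sum.inl).union ((h'.fin i j).image Sum.inr)).subset ?_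
    rintro (x | y) hz
    · exact Or.inl ⟨x, hz, rfl⟩
    · exact Or.inr ⟨y, hz, rfl⟩
  refine ⟨⟨min a a', min b b', ?_⟩, fin, fun i j => ?_⟩
  · rintro (x | y)
    · have := hab x
      simp only [Sum.elim_inl]
      omega
    · have := hab' y
      simp only [Sum.elim_inr]
      omega
  · have : (fin i j).toFinset = (h.fin i j).toFinset.disjSum (h'.fin i j).toFinset := by
      ext (x | y) <;> simp
    rw [this, Finset.sum_disjSum, HahnSeries.coeff_add, HahnSeries.coeff_add, h.coeff, h'.coeff]
    rfl

lemma unit (d : Deg) : IsCount (fun _ : Unit => d) (sgn d.2.2 • qlam d.1 d.2.1) where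
  bdd := ⟨d.1, d.2.1, fun _ => ⟨le_rfl, le_rfl⟩⟩
  fin i j := Set.toFinite _
  coeff i j := by
    rw [HahnSeries.coeff_smul, HahnSeries.coeff_smul, qlam]
    by_cases h : d.1 = i ∧ d.2.1 = j
    · obtain ⟨rfl, rfl⟩ := h
      have : (Set.toFinite {x : Unit | d.1 = d.1 ∧ d.2.1 = d.2.1}).toFinset = {()} := by
        ext; simp
      rw [this]
      simp
    · have : (Set.toFinite {x : Unit | d.1 = i ∧ d.2.1 = j}).toFinset = ∅ := by
        ext x
        rw [Set.Finite.mem_toFinset]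
        exact iff_of_false h (Finset.notMem_empty x)
      rw [this, Finset.sum_empty]
      by_cases hj : j = d.2.1
      · subst hj
        have hi : i ≠ d.1 := fun hi => h ⟨hi.symm, rfl⟩
        rw [HahnSeries.coeff_single_same, HahnSeries.coeff_single_of_ne hi, smul_zero]
      · rw [HahnSeries.coeff_single_of_ne hj, HahnSeries.coeff_zero, smul_zero]

lemma pi {k : ℕ} {Y : Type} (deg : Fin k → Y → Deg) (c : Fin k → Ser)
    (h : ∀ i, IsCount (deg i) (c i)) :
    IsCount (fun z : Fin k → Y => ∑ i, deg i (z i)) (∏ i, c i) := by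
  induction k with
  | zero =>
    have h1 := (unit 0).comp_equiv (Equiv.ofUnique (Fin 0 → Y) Unit)
    have e : sgn (0 : Deg).2.2 • qlam (0 : Deg).1 (0 : Deg).2.1 = 1 := by
      simp [sgn, qlam]
    rw [e] at h1
    simpa using h1
  | succ k ih =>
    rw [Fin.prod_univ_succ]
    refine (((h 0).mul (ih _ _ fun i => h i.succ)).comp_equiv
      (Fin.consEquiv fun _ => Y).symm).congr fun z => ?_
    rw [Fin.sum_univ_succ]
    rfl

end IsCount

/-! ### Monomials of `Ω_k` -/

/-- The powers of one even generator are counted by a geometric series. -/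
lemma isCount_nat (n : ℕ) : IsCount (fun l : ℕ => ((2 * ((n : ℤ) + 1) * l, 0, 0) : Deg))
    (expand (LaurentPolynomial.C (1 - q ^ (2 * ((n : ℤ) + 1)))⁻¹)) := by
  obtain ⟨c, hc⟩ := IsCount.exists_of (deg := fun l : ℕ => ((2 * ((n : ℤ) + 1) * l, 0, 0) : Deg))
    ⟨0, 0, fun x => ⟨by positivity, le_rfl⟩⟩ (fun i j => by
      refine Set.Subsingleton.finite fun x hx y hy => ?_
      have h1 := hx.1.trans hy.1.symm
      have h2 := mul_left_cancel₀ (by positivity) h1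
      exact_mod_cast h2)
  -- The bijection of `ℕ` with a point plus a shifted copy of `ℕ` gives `c = 1 + q^{2(n+1)} c`,
  -- which identifies `c` with the expanded inverse without computing its coefficients.
  have h1 := ((IsCount.unit 0).sum ((IsCount.unit (2 * ((n : ℤ) + 1), 0, 0)).mul hc)).comp_equiv
    (Y := ℕ) (((Equiv.sumComm _ _).trans ((Equiv.sumCongr (Equiv.punitProd ℕ) (Equiv.refl Unit)).trans
      Equiv.natSumPUnitEquivNat)).symm)
  have h2 := h1.congr (deg₁ := fun l : ℕ => ((2 * ((n : ℤ) + 1) * l, 0, 0) : Deg)) (fun l => by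
    cases l with
    | zero => simp; rfl
    | succ l =>
      change _ = ((2 * ((n : ℤ) + 1), 0, 0) : Deg) + ((2 * ((n : ℤ) + 1) * l, 0, 0) : Deg)
      simp only [Prod.mk_add_mk, add_zero]
      congr 1
      push_cast; ring)
  have h3 := hc.unique h2
  have e0 : sgn (0 : Deg).2.2 • qlam (0 : Deg).1 (0 : Deg).2.1 = 1 := by
    simp [sgn, qlam]
  rw [e0] at h3
  simp only [sgn_zero, one_smul] at h3
  have e1 : expand (LaurentPolynomial.C (1 - q ^ (2 * ((n : ℤ) + 1)))) =
      1 - qlam (2 * ((n : ℤ) + 1)) 0 := by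
    have := expand_monomial (2 * ((n : ℤ) + 1)) 0
    rw [LaurentPolynomial.T_zero, mul_one] at this
    rw [map_sub, map_sub, map_one, map_one, this, qlam]
  have e2 : expand (LaurentPolynomial.C (1 - q ^ (2 * ((n : ℤ) + 1)))) *
      expand (LaurentPolynomial.C (1 - q ^ (2 * ((n : ℤ) + 1)))⁻¹) = 1 := by
    rw [← map_mul, ← map_mul, mul_inv_cancel₀ (one_sub_q_ne_zero n), map_one, map_one]
  have e3 : expand (LaurentPolynomial.C (1 - q ^ (2 * ((n : ℤ) + 1)))) * c = 1 := by
    rw [e1]; linear_combination h3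
  have e4 : expand (LaurentPolynomial.C (1 - q ^ (2 * ((n : ℤ) + 1)))⁻¹) = c := by
    linear_combination c * e2 - expand (LaurentPolynomial.C (1 - q ^ (2 * ((n : ℤ) + 1)))⁻¹) * e3
  rwa [e4]

/-- An odd generator occurs at most once in a monomial, and then with sign `-1`. -/
lemma isCount_bool (n : ℕ) : IsCount
    (fun b : Bool => bif b then ((-(2 * ((n : ℤ) + 1)), 2, 1) : Deg) else 0)
    (expand (1 - LaurentPolynomial.C (q ^ (-(2 * ((n : ℤ) + 1)))) * LaurentPolynomial.T 2)) := by
  have h1 := ((IsCount.unit 0).sum (IsCount.unit (-(2 * ((n : ℤ) + 1)), 2, 1))).comp_equiv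
    Equiv.boolEquivPUnitSumPUnit
  have e0 : sgn (0 : Deg).2.2 • qlam (0 : Deg).1 (0 : Deg).2.1 = 1 := by
    simp [sgn, qlam]
  rw [e0] at h1
  have e1 : expand (1 - LaurentPolynomial.C (q ^ (-(2 * ((n : ℤ) + 1)))) * LaurentPolynomial.T 2) =
      1 + sgn 1 • qlam (-(2 * ((n : ℤ) + 1))) 2 := by
    rw [map_sub, map_one, expand_monomial, sgn_one, sub_eq_add_neg, qlam]
    congr 1
    exact ser_ext fun i j => by simp
  rw [e1]
  exact h1.congr (fun b => by cases b <;> rfl)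

/-- Monomials of `Ω_k` as families of exponents. -/
def monEquiv (k : ℕ) : (Fin k →₀ ℕ) × Finset (Fin k) ≃ (Fin k → ℕ × Bool) where
  toFun a i := (a.1 i, decide (i ∈ a.2))
  invFun z := (Finsupp.equivFunOnFinite.symm fun i => (z i).1,
    Finset.univ.filter fun i => (z i).2 = true)
  left_inv a := by
    refine Prod.ext ?_ ?_
    · ext; simp
    · ext; simp
  right_inv z := by
    funext i
    simp

lemma monDeg_eq_sum {k : ℕ} (a : (Fin k →₀ ℕ) × Finset (Fin k)) :
    monDeg a = ∑ i : Fin k, (((2 * (((i : ℕ) : ℤ) + 1) * (a.1 i : ℤ), 0, 0) : Deg) +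
      bif decide (i ∈ a.2) then ((-(2 * (((i : ℕ) : ℤ) + 1)), 2, 1) : Deg) else 0) := by
  rw [Finset.sum_add_distrib]
  have h2 : ∑ i : Fin k, (bif decide (i ∈ a.2) then ((-(2 * (((i : ℕ) : ℤ) + 1)), 2, 1) : Deg) else 0)
      = ∑ i ∈ a.2, ((-(2 * (((i : ℕ) : ℤ) + 1)), 2, 1) : Deg) := by
    rw [← Finset.sum_filter_add_sum_filter_not Finset.univ (fun i => i ∈ a.2)]
    rw [Finset.sum_eq_zero (s := Finset.univ.filter fun i => i ∉ a.2), add_zero]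
    · refine Finset.sum_congr (by ext; simp) fun i hi => ?_
      simp [hi]
    · intro i hi
      simp at hi
      simp [hi]
  rw [h2]
  refine Prod.ext ?_ (Prod.ext ?_ ?_)
  · simp [monDeg, Prod.fst_sum, sub_eq_add_neg]
  · simp [monDeg, Prod.snd_sum, mul_comm]
  · simp [monDeg, Prod.snd_sum]

/-- The graded dimension of `Ω_k` is the norm of `m_k`. -/
theorem isCount_monDeg (k : ℕ) : IsCount (monDeg (k := k)) (expand (shapCoef k)) := by
  have h := (IsCount.pi (k := k) _ _ fun i =>
    (isCount_nat (i : ℕ)).mul (isCount_bool (i : ℕ))).comp_equiv (monEquiv k)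
  have e : expand (shapCoef k) = ∏ i : Fin k,
      (expand (LaurentPolynomial.C (1 - q ^ (2 * (((i : ℕ) : ℤ) + 1)))⁻¹) *
        expand (1 - LaurentPolynomial.C (q ^ (-(2 * (((i : ℕ) : ℤ) + 1)))) *
          LaurentPolynomial.T 2)) := by
    simp only [← map_mul]
    rw [← map_prod, shapCoef, ← Fin.prod_univ_eq_prod_range (fun n : ℕ =>
      (LaurentPolynomial.C (1 - q ^ (2 * ((n : ℤ) + 1)))⁻¹ *
      (1 - LaurentPolynomial.C (q ^ (-(2 * ((n : ℤ) + 1)))) * LaurentPolynomial.T 2)))]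
  rw [e]
  exact h.congr monDeg_eq_sum

/-! ## Graded projective modules over a connected graded algebra are graded free -/

section Abstract

variable {K R ι D P : Type*} [Field K] [Ring R] [Algebra K R] [AddCommGroup P] [Module K P]

/-- The degree projections are recorded through the three properties used later, so that no further
computation in the direct sum is needed. -/
lemma exists_proj [DecidableEq D] {gr : D → Submodule K P} (h : DirectSum.IsInternal gr) :
    ∃ p : D → P →ₗ[K] P, (∀ d, ∀ v ∈ gr d, p d v = v) ∧
      (∀ d e, ∀ v ∈ gr e, e ≠ d → p d v = 0) ∧ ∀ d v, p d v ∈ gr d := by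
  let E := LinearEquiv.ofBijective (DirectSum.coeLinearMap gr) h
  have hE : ∀ d (v : gr d), E.symm v = DirectSum.lof K D (fun d => gr d) d v := fun d v => by
    rw [LinearEquiv.symm_apply_eq]
    exact (DirectSum.coeLinearMap_lof gr d v).symm
  refine ⟨fun d => (gr d).subtype ∘ₗ DirectSum.component K D (fun d => gr d) d ∘ₗ E.symm.toLinearMap,
    fun d v hv => ?_, fun d e v hv hne => ?_, fun d v => ?_⟩
  · simp only [LinearMap.comp_apply, LinearEquiv.coe_coe]
    rw [hE d ⟨v, hv⟩, DirectSum.component.lof_self]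
    rfl
  · simp only [LinearMap.comp_apply, LinearEquiv.coe_coe]
    rw [hE e ⟨v, hv⟩, DirectSum.component.of, dif_neg hne, map_zero]
  · exact SetLike.coe_mem _

variable [AddCommGroup D]

/-- A basis of an algebra that is homogeneous for a grading whose part of weight zero is spanned
by `1`, the other weights being positive. -/
structure IsConnectedBasis (β : Module.Basis ι K R) (deg : ι → D) (o : ι) (W : D →+ ℤ) : Prop where
  one : β o = 1
  deg_one : deg o = 0
  mul_mem : ∀ a b, β a * β b ∈ Submodule.span K (β '' {l | deg l = deg a + deg b})
  pos : ∀ l, l ≠ o → 0 < W (deg l)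

variable {β : Module.Basis ι K R} {deg : ι → D} {o : ι} {W : D →+ ℤ}

/-- The span of the basis elements of weight at least `n`. -/
def weightFiltration (β : Module.Basis ι K R) (deg : ι → D) (W : D →+ ℤ) (n : ℕ) :
    Submodule K R :=
  Submodule.span K (β '' {l | (n : ℤ) ≤ W (deg l)})

lemma weightFiltration_mul {r s : R} {n k : ℕ} (hβ : IsConnectedBasis β deg o W)
    (hr : r ∈ weightFiltration β deg W n) (hs : s ∈ weightFiltration β deg W k) :
    r * s ∈ weightFiltration β deg W (n + k) := by
  have h : weightFiltration β deg W n * weightFiltration β deg W k ≤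
      weightFiltration β deg W (n + k) := by
    rw [weightFiltration, weightFiltration, Submodule.span_mul_span, Submodule.span_le]
    rintro _ ⟨_, ⟨a, ha, rfl⟩, _, ⟨b, hb, rfl⟩, rfl⟩
    refine Submodule.span_mono (Set.image_mono fun l hl => ?_) (hβ.mul_mem a b)
    simp only [Set.mem_ofPred_eq] at ha hb hl ⊢
    rw [hl, map_add]
    push_cast
    omega
  exact h (Submodule.mul_mem_mul hr hs)

lemma IsConnectedBasis.weight_nonneg (hβ : IsConnectedBasis β deg o W) (l : ι) :
    0 ≤ W (deg l) := by
  by_cases h : l = o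
  · rw [h, hβ.deg_one, map_zero]
  · exact (hβ.pos l h).le

lemma mem_weightFiltration_zero (hβ : IsConnectedBasis β deg o W) (r : R) :
    r ∈ weightFiltration β deg W 0 := by
  have : {l | ((0 : ℕ) : ℤ) ≤ W (deg l)} = Set.univ :=
    Set.eq_univ_of_forall fun l => hβ.weight_nonneg l
  rw [weightFiltration, this, Set.image_univ, β.span_eq]
  trivial

lemma mem_weightFiltration_one (hβ : IsConnectedBasis β deg o W) {r : R} (hr : β.repr r o = 0) :
    r ∈ weightFiltration β deg W 1 := by
  rw [weightFiltration, β.mem_span_image]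
  intro l hl
  have : l ≠ o := by
    rintro rfl
    exact Finsupp.mem_support_iff.1 hl hr
  exact hβ.pos l this

lemma eq_zero_of_mem_weightFiltration {r : R} (hr : ∀ n, r ∈ weightFiltration β deg W n) :
    r = 0 := by
  refine β.repr.injective (Finsupp.ext fun l => ?_)
  rw [map_zero, Finsupp.zero_apply]
  by_contra hne
  -- A basis element occurring in `r` would be excluded one step beyond its own weight.
  have h := hr ((W (deg l)).toNat + 1)
  rw [weightFiltration, β.mem_span_image] at h
  have h2 := h (Finsupp.mem_support_iff.2 hne)
  simp only [Set.mem_ofPred_eq] at h2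
  omega

variable [Module R P]

/-- The part of degree `d` of the augmentation ideal times the module. -/
def decomposables (β : Module.Basis ι K R) (deg : ι → D) (o : ι) (gr : D → Submodule K P) (d : D) :
    Submodule K P :=
  Submodule.span K {x | ∃ l e v, l ≠ o ∧ v ∈ gr e ∧ deg l + e = d ∧ x = β l • v}

lemma decomposables_le {gr : D → Submodule K P}
    (hsmul : ∀ l e, ∀ v ∈ gr e, β l • v ∈ gr (deg l + e)) (d : D) :
    decomposables β deg o gr d ≤ gr d := by
  rw [decomposables, Submodule.span_le]
  rintro _ ⟨l, e, v, _, hv, rfl, rfl⟩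
  exact hsmul l e v hv

/-- A complement in the whole space, cut down to `gr d`, remains a complement there by the modular
law. It plays the role of the degree `d` part of the module modulo the augmentation ideal. -/
lemma exists_indecomposables {gr : D → Submodule K P}
    (hsmul : ∀ l e, ∀ v ∈ gr e, β l • v ∈ gr (deg l + e)) (d : D) :
    ∃ C : Submodule K P, C ≤ gr d ∧ decomposables β deg o gr d ⊔ C = gr d ∧
      decomposables β deg o gr d ⊓ C = ⊥ := by
  obtain ⟨Q, hQ⟩ := Submodule.exists_isCompl (decomposables β deg o gr d)
  refine ⟨Q ⊓ gr d, inf_le_right, ?_, ?_⟩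
  · rw [← sup_inf_assoc_of_le Q (decomposables_le hsmul d), hQ.sup_eq_top, top_inf_eq]
  · rw [← inf_assoc, hQ.inf_eq_bot, bot_inf_eq]

/-- The graded Nakayama lemma. -/
lemma span_eq_top_of_indecomposables [DecidableEq D] [IsScalarTower K R P] {gr : D → Submodule K P} (hint : DirectSum.IsInternal gr)
    {w : ℤ} (hw : ∀ d, W d < w → gr d = ⊥) (hβ : IsConnectedBasis β deg o W)
    {C : D → Submodule K P} (hC : ∀ d, decomposables β deg o gr d ⊔ C d = gr d)
    {s : Set P} (hs : ∀ d, ∀ v ∈ C d, v ∈ Submodule.span R s) : Submodule.span R s = ⊤ := by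
  -- Induction on the weight above the lower bound `w`: in a decomposable `β l • v` the factor `v`
  -- has strictly smaller weight.
  have key : ∀ n : ℕ, ∀ d, W d < w + n → gr d ≤ (Submodule.span R s).restrictScalars K := by
    intro n
    induction n with
    | zero =>
      intro d hd
      rw [hw d (by simpa using hd)]
      exact bot_le
    | succ n ih =>
      intro d hd
      rw [← hC d, sup_le_iff]
      refine ⟨?_, hs d⟩
      rw [decomposables, Submodule.span_le]
      rintro _ ⟨l, e, v, hl, hv, rfl, rfl⟩
      refine Submodule.smul_mem (Submodule.span R s) (β l) (ih e ?_ hv)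
      have := hβ.pos l hl
      rw [map_add] at hd
      push_cast at hd
      omega
  have h2 : (Submodule.span R s).restrictScalars K = ⊤ := by
    rw [eq_top_iff, ← hint.submodule_iSup_eq_top]
    refine iSup_le fun d => key (W d - w + 1).toNat d ?_
    omega
  rw [← Submodule.restrictScalars_eq_top_iff K]
  exact h2

/-- Families of indecomposables are linearly independent modulo the augmentation ideal. -/
lemma repr_eq_zero_of_indecomposables [DecidableEq D] [IsScalarTower K R P] {gr : D → Submodule K P} (hint : DirectSum.IsInternal gr)
    (hsmul : ∀ l e, ∀ v ∈ gr e, β l • v ∈ gr (deg l + e)) (hβ : IsConnectedBasis β deg o W)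
    {C : D → Submodule K P} (hCle : ∀ d, C d ≤ gr d)
    (hC : ∀ d, decomposables β deg o gr d ⊓ C d = ⊥)
    {B : D → Type*} (c : ∀ d, Module.Basis (B d) K (C d))
    (x : (Σ d, B d) →₀ R)
    (hx : Finsupp.linearCombination R (fun a : Σ d, B d => (c a.1 a.2 : P)) x = 0)
    (a : Σ d, B d) : β.repr (x a) o = 0 := by
  classical
  obtain ⟨p, p1, p2, p3⟩ := exists_proj hint
  obtain ⟨d, i⟩ := a
  set f : (Σ d, B d) → P := fun a => (c a.1 a.2 : P) with hf
  -- reduction modulo the augmentation ideal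
  let y : (Σ d, B d) →₀ K := x.mapRange (fun r => β.repr r o) (by simp)
  -- Subtracting the constant term of `r` leaves only basis elements `β l` with `l ≠ o`, and
  -- projection to degree `d` turns each resulting term into a decomposable or zero.
  have h1 : ∀ (a : Σ d, B d) (r : R), p d (r • f a - β.repr r o • f a) ∈
      decomposables β deg o gr d := by
    intro a r
    have ha : f a ∈ gr a.1 := hCle _ (c a.1 a.2).2
    have e1 : r • f a - β.repr r o • f a =
        ∑ l ∈ (β.repr r).support.erase o, β.repr r l • (β l • f a) := by
      have e2 : r • f a = ∑ l ∈ (β.repr r).support, β.repr r l • (β l • f a) := by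
        conv_lhs => rw [← β.linearCombination_repr r, Finsupp.linearCombination_apply,
          Finsupp.sum, Finset.sum_smul]
        simp only [smul_assoc]
      by_cases ho : o ∈ (β.repr r).support
      · rw [e2, ← Finset.add_sum_erase _ _ ho, hβ.one, one_smul, add_sub_cancel_left]
      · rw [Finset.erase_eq_of_notMem ho, e2, Finsupp.notMem_support_iff.1 ho, zero_smul, sub_zero]
    rw [e1, map_sum]
    refine Submodule.sum_mem _ fun l hl => ?_
    rw [map_smul]
    refine Submodule.smul_mem _ _ ?_
    have hm := hsmul l _ _ ha
    by_cases hd : deg l + a.1 = d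
    · rw [p1 d _ (hd ▸ hm)]
      exact Submodule.subset_span ⟨l, a.1, f a, Finset.ne_of_mem_erase hl, ha, hd, rfl⟩
    · rw [p2 d _ _ hm hd]
      exact Submodule.zero_mem _
  have h2 : p d (Finsupp.linearCombination K f y) ∈ decomposables β deg o gr d := by
    have e : Finsupp.linearCombination K f y = -∑ a ∈ x.support, (x a • f a - β.repr (x a) o • f a) := by
      rw [Finset.sum_sub_distrib]
      rw [Finsupp.linearCombination_apply, Finsupp.sum] at hx
      rw [hx, Finsupp.linearCombination_apply, Finsupp.sum_mapRange_index (by simp)]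
      simp [Finsupp.sum]
    rw [e, map_neg, map_sum]
    exact Submodule.neg_mem _ (Submodule.sum_mem _ fun a _ => h1 a _)
  -- the component of degree `d`
  let z : B d →₀ K := y.comapDomain (Sigma.mk d) sigma_mk_injective.injOn
  have h3 : p d (Finsupp.linearCombination K f y) = (Finsupp.linearCombination K (c d) z : C d) := by
    have e : ∀ y : (Σ d, B d) →₀ K, p d (Finsupp.linearCombination K f y) =
        (Finsupp.linearCombination K (c d) (y.comapDomain (Sigma.mk d) sigma_mk_injective.injOn) :
          C d) := by
      intro y
      induction y using Finsupp.induction_linear with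
      | zero => simp
      | add y y' hy hy' =>
        rw [map_add, map_add, hy, hy', Finsupp.comapDomain_add_of_injective sigma_mk_injective,
          map_add]
        rfl
      | single a k =>
        obtain ⟨e, j⟩ := a
        rw [Finsupp.linearCombination_single, map_smul]
        by_cases hed : e = d
        · subst hed
          rw [Finsupp.comapDomain_single, Finsupp.linearCombination_single, p1 e _ (hCle _ (c e j).2)]
          rfl
        · rw [p2 d e _ (hCle _ (c e j).2) hed, smul_zero]
          have : (Finsupp.single (⟨e, j⟩ : Σ d, B d) k).comapDomain (Sigma.mk d)
              sigma_mk_injective.injOn = 0 := by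
            ext j'
            rw [Finsupp.comapDomain_apply, Finsupp.single_eq_of_ne, Finsupp.zero_apply]
            rintro h
            exact hed (congrArg Sigma.fst h).symm
          rw [this, map_zero]
          rfl
    exact e y
  -- The combination of constant terms is decomposable and also lies in the complement `C d`.
  have h4 : (Finsupp.linearCombination K (c d) z : C d) = 0 := by
    have : ((Finsupp.linearCombination K (c d) z : C d) : P) ∈
        decomposables β deg o gr d ⊓ C d := ⟨h3 ▸ h2, SetLike.coe_mem _⟩
    rw [hC d] at this
    exact Subtype.ext ((Submodule.mem_bot K).1 this)
  have h5 := linearIndependent_iff.1 (c d).linearIndependent z h4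
  have h6 := DFunLike.congr_fun h5 i
  rw [Finsupp.comapDomain_apply, Finsupp.mapRange_apply] at h6
  exact h6

/-- A graded projective module that is bounded from below has a homogeneous basis. -/
theorem exists_homogeneous_basis {P : Type u} [AddCommGroup P] [Module K P] [Module R P]
    [IsScalarTower K R P] {D : Type} [AddCommGroup D] [DecidableEq D] {deg : ι → D} {W : D →+ ℤ}
    {gr : D → Submodule K P} (hint : DirectSum.IsInternal gr)
    (hsmul : ∀ l e, ∀ v ∈ gr e, β l • v ∈ gr (deg l + e)) (hβ : IsConnectedBasis β deg o W)
    {w : ℤ} (hw : ∀ d, W d < w → gr d = ⊥) (hfin : ∀ d, Module.Finite K (gr d))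
    [Module.Projective R P] :
    ∃ (A : Type u) (b : Module.Basis A R P) (dg : A → D), (∀ a, b a ∈ gr (dg a)) ∧
      ∀ d, {a | dg a = d}.Finite := by
  choose C hCle hCsup hCinf using exists_indecomposables (o := o) (gr := gr) hsmul
  let c := fun d => Module.Basis.ofVectorSpace K (C d)
  let f : (Σ d, Module.Basis.ofVectorSpaceIndex K (C d)) → P := fun a => (c a.1 a.2 : P)
  have hspan : Submodule.span R (Set.range f) = ⊤ := by
    refine span_eq_top_of_indecomposables hint hw hβ hCsup fun d v hv => ?_
    have h1 := (c d).mem_span ⟨v, hv⟩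
    have h2 := Submodule.mem_map_of_mem (f := (C d).subtype) h1
    rw [Submodule.map_span] at h2
    refine Submodule.span_le_restrictScalars K R _ (Submodule.span_mono ?_ h2)
    rintro _ ⟨_, ⟨i, rfl⟩, rfl⟩
    exact ⟨⟨d, i⟩, rfl⟩
  have hsurj : Function.Surjective (Finsupp.linearCombination R f) := by
    rw [← LinearMap.range_eq_top, Finsupp.range_linearCombination, hspan]
  -- The section need not respect the grading; only the filtration by weight is used below.
  obtain ⟨s, hs⟩ := Module.projective_lifting_property (Finsupp.linearCombination R f)
    LinearMap.id hsurj
  have hker : ∀ x, Finsupp.linearCombination R f x = 0 → ∀ a, x a ∈ weightFiltration β deg W 1 :=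
    fun x hx a => mem_weightFiltration_one hβ
      (repr_eq_zero_of_indecomposables hint hsmul hβ hCle hCinf c x hx a)
  have hall : ∀ n x, Finsupp.linearCombination R f x = 0 →
      ∀ a, x a ∈ weightFiltration β deg W n := by
    intro n
    induction n with
    | zero => exact fun x _ a => mem_weightFiltration_zero hβ _
    | succ n ih =>
      intro x hx a
      -- `e` projects the free module onto the kernel of the presentation. It fixes `x`, and the
      -- coefficients of its values lie in filtration step one, so expanding `x = e x` raises the
      -- filtration of the coefficients of `x` by one.
      let e := LinearMap.id - s ∘ₗ Finsupp.linearCombination R f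
      have he : ∀ y, Finsupp.linearCombination R f (e y) = 0 := fun y => by
        have := LinearMap.congr_fun hs (Finsupp.linearCombination R f y)
        simp only [LinearMap.comp_apply, LinearMap.id_apply] at this
        simp only [e, LinearMap.sub_apply, LinearMap.id_apply, LinearMap.comp_apply, map_sub, this,
          sub_self]
      have hex : e x = x := by
        simp only [e, LinearMap.sub_apply, LinearMap.id_apply, LinearMap.comp_apply, hx, map_zero,
          sub_zero]
      have hsum : x a = ∑ i ∈ x.support, x i * (e (Finsupp.single i 1)) a := by
        conv_lhs => rw [← hex, ← Finsupp.sum_single x, Finsupp.sum, map_sum, Finsupp.finsetSum_apply]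
        refine Finset.sum_congr rfl fun i _ => ?_
        have : (Finsupp.single i (x i) : _ →₀ R) = x i • Finsupp.single i 1 := by
          rw [Finsupp.smul_single, smul_eq_mul, mul_one]
        rw [this, map_smul, Finsupp.smul_apply, smul_eq_mul]
      rw [hsum]
      exact Submodule.sum_mem _ fun i _ => weightFiltration_mul hβ (ih x hx i) (hker _ (he _) a)
  have hli : LinearIndependent R f := linearIndependent_iff.2 fun x hx =>
    Finsupp.ext fun a => eq_zero_of_mem_weightFiltration fun n => hall n x hx a
  refine ⟨_, Module.Basis.mk hli hspan.ge, fun a => a.1, fun a => ?_, fun d => ?_⟩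
  · rw [Module.Basis.mk_apply]
    exact hCle _ (c a.1 a.2).2
  · have : Module.Finite K (C d) := Submodule.finiteDimensional_of_le (hCle d)
    have : Finite (Module.Basis.ofVectorSpaceIndex K (C d)) := Module.Finite.finite_basis (c d)
    refine (Set.finite_range fun i : Module.Basis.ofVectorSpaceIndex K (C d) =>
      (⟨d, i⟩ : Σ d, Module.Basis.ofVectorSpaceIndex K (C d))).subset ?_
    rintro ⟨e, i⟩ rfl
    exact ⟨i, rfl⟩

end Abstract

/-! ## The grading of `Ω_k` -/

lemma omegaBasis_apply {k : ℕ} (a : (Fin k →₀ ℕ) × Finset (Fin k)) :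
    omegaBasis k a = MvPolynomial.monomial a.1 1 ⊗ₜ (Pi.basisFun ℚ (Fin k)).ExteriorAlgebra a.2 := by
  rw [omegaBasis, Module.Basis.tensorProduct_apply, MvPolynomial.coe_basisMonomials]

lemma omegaBasis_zero (k : ℕ) : omegaBasis k (0, ∅) = 1 := by
  rw [omegaBasis_apply, Algebra.TensorProduct.one_def]
  congr 1
  rw [ExteriorAlgebra.basis_apply_ofCard (n := 0) _ Finset.card_empty]
  simp

lemma monDeg_zero (k : ℕ) : monDeg ((0, ∅) : (Fin k →₀ ℕ) × Finset (Fin k)) = 0 := by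
  simp [monDeg]

lemma monDeg_add {k : ℕ} (α β : Fin k →₀ ℕ) {S T : Finset (Fin k)} (h : Disjoint S T) :
    monDeg (α + β, S ∪ T) = monDeg (α, S) + monDeg (β, T) := by
  refine Prod.ext ?_ (Prod.ext ?_ ?_)
  · simp only [monDeg, Prod.fst_add, Finset.sum_union h, Finsupp.add_apply]
    push_cast
    simp only [mul_add, Finset.sum_add_distrib]
    ring
  · simp only [monDeg, Prod.fst_add, Prod.snd_add, Finset.card_union_of_disjoint h]
    push_cast; ring
  · simp only [monDeg, Prod.snd_add, Finset.card_union_of_disjoint h]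
    push_cast; ring

/-- A product of two monomials is zero if they share an odd generator, and otherwise is a monomial
up to the sign of the sorting permutation. -/
lemma omegaBasis_mul {k : ℕ} (a b : (Fin k →₀ ℕ) × Finset (Fin k)) :
    omegaBasis k a * omegaBasis k b ∈ omegaGr k (monDeg a + monDeg b) := by
  obtain ⟨α, S⟩ := a
  obtain ⟨β, T⟩ := b
  let E := (Pi.basisFun ℚ (Fin k)).ExteriorAlgebra
  rw [omegaBasis_apply, omegaBasis_apply, Algebra.TensorProduct.tmul_mul_tmul,
    MvPolynomial.monomial_mul, one_mul]
  by_cases h : Disjoint S T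
  · have h1 := ExteriorAlgebra.basis_mul_of_disjoint (Pi.basisFun ℚ (Fin k))
      (⟨S, rfl⟩ : Set.powersetCard (Fin k) S.card) (⟨T, rfl⟩ : Set.powersetCard (Fin k) T.card) h
    have h2 : omegaBasis k (α + β, S ∪ T) ∈ omegaGr k (monDeg (α, S) + monDeg (β, T)) :=
      Submodule.subset_span ⟨_, monDeg_add α β h, rfl⟩
    rw [omegaBasis_apply] at h2
    change E S * E T = _ at h1
    have h3 : ((Set.powersetCard.disjUnion (s := (⟨S, rfl⟩ : Set.powersetCard (Fin k) S.card))
      (t := (⟨T, rfl⟩ : Set.powersetCard (Fin k) T.card)) h : Set.powersetCard _ _) :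
        Finset (Fin k)) = S ∪ T := by
      ext i; simp
    rw [h3] at h1
    change MvPolynomial.monomial (α + β) 1 ⊗ₜ (E S * E T) ∈ _
    rw [h1]
    rcases Int.units_eq_one_or (Equiv.Perm.sign (Set.powersetCard.permOfDisjoint
      (s := (⟨S, rfl⟩ : Set.powersetCard (Fin k) S.card))
      (t := (⟨T, rfl⟩ : Set.powersetCard (Fin k) T.card)) h)) with h4 | h4
    · rw [h4, one_smul]; exact h2
    · rw [h4, Units.neg_smul, one_smul, TensorProduct.tmul_neg]
      exact Submodule.neg_mem _ h2
  · have h1 := ExteriorAlgebra.basis_mul_of_not_disjoint (Pi.basisFun ℚ (Fin k))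
      (⟨S, rfl⟩ : Set.powersetCard (Fin k) S.card) (⟨T, rfl⟩ : Set.powersetCard (Fin k) T.card) h
    change E S * E T = _ at h1
    change MvPolynomial.monomial (α + β) 1 ⊗ₜ (E S * E T) ∈ _
    rw [h1, TensorProduct.tmul_zero]
    exact Submodule.zero_mem _

/-- The weight `(i, j, p) ↦ i + (k + 1) j`, for which all generators of `Ω_k` are positive. -/
def weight (k : ℕ) : Deg →+ ℤ where
  toFun d := d.1 + ((k : ℤ) + 1) * d.2.1
  map_zero' := by simp
  map_add' d e := by simp only [Prod.fst_add, Prod.snd_add]; ring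

lemma weight_monDeg {k : ℕ} (a : (Fin k →₀ ℕ) × Finset (Fin k)) :
    weight k (monDeg a) = ∑ i : Fin k, 2 * ((i : ℤ) + 1) * (a.1 i : ℤ) +
      ∑ i ∈ a.2, 2 * ((k : ℤ) - (i : ℕ)) := by
  change (∑ i : Fin k, 2 * ((i : ℤ) + 1) * (a.1 i : ℤ) - ∑ i ∈ a.2, 2 * ((i : ℤ) + 1)) +
    ((k : ℤ) + 1) * (2 * (a.2.card : ℤ)) = _
  have : ((k : ℤ) + 1) * (2 * (a.2.card : ℤ)) = ∑ i ∈ a.2, 2 * ((k : ℤ) + 1) := by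
    rw [Finset.sum_const, nsmul_eq_mul]; ring
  rw [this, sub_add, sub_eq_add_neg, ← Finset.sum_sub_distrib, ← Finset.sum_neg_distrib]
  congr 1
  refine Finset.sum_congr rfl fun i _ => ?_
  ring

/-- The factor `k + 1` in the weight outweighs the negative quantum degrees: the odd generator with
index `i : Fin k` has weight `2(k - i) > 0`. -/
lemma isConnectedBasis_omegaBasis (k : ℕ) :
    IsConnectedBasis (omegaBasis k) monDeg (0, ∅) (weight k) where
  one := omegaBasis_zero k
  deg_one := monDeg_zero k
  mul_mem := omegaBasis_mul
  pos := by
    rintro ⟨α, S⟩ h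
    rw [weight_monDeg]
    have h1 : ∀ i : Fin k, 0 ≤ 2 * ((i : ℤ) + 1) * (α i : ℤ) := fun i => by positivity
    have h2 : ∀ i ∈ S, 0 < 2 * ((k : ℤ) - (i : ℕ)) := fun i _ => by have := i.2; omega
    by_cases hS : S = ∅
    · subst hS
      have : α ≠ 0 := fun h' => h (by rw [h'])
      obtain ⟨i, hi⟩ := Finsupp.ne_iff.1 this
      rw [Finset.sum_empty, add_zero]
      refine Finset.sum_pos' (fun i _ => h1 i) ⟨i, Finset.mem_univ i, ?_⟩
      have : 0 < α i := Nat.pos_of_ne_zero hi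
      positivity
    · exact add_pos_of_nonneg_of_pos (Finset.sum_nonneg fun i _ => h1 i)
        (Finset.sum_pos h2 (Finset.nonempty_iff_ne_empty.2 hS))

lemma omegaBasis_mem {k : ℕ} (a : (Fin k →₀ ℕ) × Finset (Fin k)) :
    omegaBasis k a ∈ omegaGr k (monDeg a) := Submodule.subset_span ⟨a, rfl, rfl⟩

/-! ### The parity twist -/

lemma koszul_add (p e e' : ZMod 2) : koszul p (e + e') = koszul p e * koszul p e' := by
  revert p e e'
  have h : ∀ p : ZMod 2, p = 0 ∨ p = 1 := by decide
  intro p e e'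
  rcases h p with rfl | rfl <;> rcases h e with rfl | rfl <;> rcases h e' with rfl | rfl <;>
    simp [koszul, show (1 + 1 : ZMod 2) = 0 by decide]

lemma koszul_zero (p : ZMod 2) : koszul p 0 = 1 := by simp [koszul]

/-- The linear map `r ↦ (-1)^{p p(r)} r` of `Ω_k`. -/
def twist (k : ℕ) (p : ZMod 2) : Omega k →ₗ[ℚ] Omega k :=
  (omegaBasis k).constr ℚ fun a => koszul p (monDeg a).2.2 • omegaBasis k a

lemma twist_basis {k : ℕ} (p : ZMod 2) (a : (Fin k →₀ ℕ) × Finset (Fin k)) :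
    twist k p (omegaBasis k a) = koszul p (monDeg a).2.2 • omegaBasis k a :=
  (omegaBasis k).constr_basis ℚ _ a

lemma twist_of_mem {k : ℕ} (p : ZMod 2) {d : Deg} {r : Omega k} (hr : r ∈ omegaGr k d) :
    twist k p r = koszul p d.2.2 • r := by
  rw [omegaGr] at hr
  induction hr using Submodule.span_induction with
  | mem x hx =>
    obtain ⟨a, ha, rfl⟩ := hx
    rw [twist_basis, show monDeg a = d from ha]
  | zero => simp
  | add x y _ _ hx hy => rw [map_add, hx, hy, smul_add]
  | smul c x _ hx => rw [map_smul, hx, smul_comm]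

lemma twist_one (k : ℕ) (p : ZMod 2) : twist k p 1 = 1 := by
  rw [← omegaBasis_zero, twist_basis, monDeg_zero]
  exact (congrArg (· • _) (koszul_zero p)).trans (one_smul _ _)

/-- The sign is multiplicative in the parity of the ring element, so twisting by it is compatible
with products of monomials. -/
lemma twist_mul {k : ℕ} (p : ZMod 2) (r s : Omega k) :
    twist k p (r * s) = twist k p r * twist k p s := by
  have h : (LinearMap.mul ℚ (Omega k)).compr₂ (twist k p) =
      (LinearMap.mul ℚ (Omega k)).compl₁₂ (twist k p) (twist k p) := by
    refine (omegaBasis k).ext fun a => (omegaBasis k).ext fun b => ?_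
    simp only [LinearMap.compr₂_apply, LinearMap.compl₁₂_apply, LinearMap.mul_apply', twist_basis]
    rw [twist_of_mem p (omegaBasis_mul a b), Prod.snd_add, Prod.snd_add, koszul_add,
      smul_mul_smul_comm]
  exact LinearMap.congr_fun₂ h r s

/-! ## Graded dimensions -/

section Homogeneous

variable {D P X : Type*} [DecidableEq D] [AddCommGroup P] [Module ℚ P] {gr : D → Submodule ℚ P}

/-- A homogeneous basis restricts to bases of the homogeneous components. -/
lemma gr_eq_span (hint : DirectSum.IsInternal gr) {deg : X → D} (b : Module.Basis X ℚ P)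
    (hb : ∀ x, b x ∈ gr (deg x)) (d : D) : gr d = Submodule.span ℚ (b '' {x | deg x = d}) := by
  obtain ⟨p, p1, p2, p3⟩ := exists_proj hint
  apply le_antisymm
  · intro v hv
    rw [← p1 d v hv, ← b.linearCombination_repr v, Finsupp.linearCombination_apply, Finsupp.sum,
      map_sum]
    refine Submodule.sum_mem _ fun x _ => ?_
    rw [map_smul]
    refine Submodule.smul_mem _ _ ?_
    by_cases hx : deg x = d
    · rw [p1 d _ (hx ▸ hb x)]
      exact Submodule.subset_span ⟨x, hx, rfl⟩
    · rw [p2 d _ _ (hb x) hx]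
      exact Submodule.zero_mem _
  · rw [Submodule.span_le]
    rintro _ ⟨x, rfl, rfl⟩
    exact hb x

lemma finrank_gr (hint : DirectSum.IsInternal gr) {deg : X → D} (b : Module.Basis X ℚ P)
    (hb : ∀ x, b x ∈ gr (deg x)) (d : D) : Module.finrank ℚ (gr d) = {x | deg x = d}.ncard := by
  rw [gr_eq_span hint b hb d]
  have hli : LinearIndependent ℚ fun x : {x | deg x = d} => b x :=
    b.linearIndependent.comp _ Subtype.val_injective
  have h := Module.finrank_eq_nat_card_basis (Module.Basis.span hli)
  rw [Set.image_eq_range, h]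
  rfl

end Homogeneous

namespace IsCount

variable {X : Type*} {deg : X → Deg} {c : Ser}

lemma sum_sgn (fin : ∀ i j, {x | (deg x).1 = i ∧ (deg x).2.1 = j}.Finite) (i j : ℤ) :
    ∑ x ∈ (fin i j).toFinset, sgn (deg x).2.2 =
      ({x | deg x = (i, j, 0)}.ncard : ℚ) - ({x | deg x = (i, j, 1)}.ncard : ℚ) := by
  have hp : ∀ p : ZMod 2, p = 0 ∨ p = 1 := by decide
  rw [← Finset.sum_filter_add_sum_filter_not _ (fun x => (deg x).2.2 = 0), sub_eq_add_neg]
  congr 1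
  · rw [Finset.sum_congr rfl (g := fun _ => 1) (fun x hx => by
      rw [(Finset.mem_filter.1 hx).2, sgn_zero]), Finset.sum_const, nsmul_eq_mul, mul_one,
      ← Set.ncard_coe_finset]
    congr 2
    ext x
    simp [Prod.ext_iff, and_assoc]
  · rw [Finset.sum_congr rfl (g := fun _ => -1) (fun x hx => by
      rw [(hp _).resolve_left (Finset.mem_filter.1 hx).2, sgn_one]), Finset.sum_const,
      nsmul_eq_mul, mul_neg, mul_one, ← Set.ncard_coe_finset]
    congr 3
    ext x
    have : (deg x).2.2 ≠ 0 ↔ (deg x).2.2 = 1 :=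
      ⟨(hp _).resolve_left, fun h => by rw [h]; decide⟩
    simp [Prod.ext_iff, and_assoc, this]

lemma coeff_ncard (h : IsCount deg c) (i j : ℤ) : (c.coeff j).coeff i =
    ({x | deg x = (i, j, 0)}.ncard : ℚ) - ({x | deg x = (i, j, 1)}.ncard : ℚ) := by
  rw [h.coeff, sum_sgn]

lemma fin_of_deg (fin : ∀ d, {x | deg x = d}.Finite) (i j : ℤ) :
    {x | (deg x).1 = i ∧ (deg x).2.1 = j}.Finite := by
  have hp : ∀ p : ZMod 2, p = 0 ∨ p = 1 := by decide
  refine ((fin (i, j, 0)).union (fin (i, j, 1))).subset ?_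
  rintro x ⟨rfl, rfl⟩
  rcases hp (deg x).2.2 with h | h
  · exact Or.inl (Prod.ext rfl (Prod.ext rfl h))
  · exact Or.inr (Prod.ext rfl (Prod.ext rfl h))

lemma of_ncard (bdd : ∃ a b : ℤ, ∀ x, a ≤ (deg x).1 ∧ b ≤ (deg x).2.1)
    (fin : ∀ d, {x | deg x = d}.Finite)
    (h : ∀ i j, (c.coeff j).coeff i =
      ({x | deg x = (i, j, 0)}.ncard : ℚ) - ({x | deg x = (i, j, 1)}.ncard : ℚ)) :
    IsCount deg c :=
  ⟨bdd, fin_of_deg fin, fun i j => by rw [h, sum_sgn]⟩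

end IsCount

lemma IsGdim.unique {V : Deg → Type u} [∀ d, AddCommGroup (V d)] [∀ d, Module ℚ (V d)] {c c' : Ser}
    (h : IsGdim V c) (h' : IsGdim V c') : c = c' :=
  ser_ext fun i j => by rw [h, h']

lemma exists_isGdim {V : Deg → Type u} [∀ d, AddCommGroup (V d)] [∀ d, Module ℚ (V d)]
    (h : IsLocallyFiniteBounded V) : ∃ c, IsGdim V c := by
  obtain ⟨-, a, b, hab⟩ := h
  refine exists_ser (a := a) (b := b) fun i j hij => ?_
  have h0 := hab i j 0 hij
  have h1 := hab i j 1 hij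
  rw [Module.finrank_zero_of_subsingleton, Module.finrank_zero_of_subsingleton, sub_self]

/-! ### Additivity of graded dimensions, and multiplicities of graded free modules -/

namespace SMod

variable {k : ℕ}

lemma isLocallyFiniteBounded (N : SMod.{u} k) : IsLocallyFiniteBounded (fun d => N.gr d) := by
  refine ⟨N.locallyFinite, ?_⟩
  obtain ⟨a, b, hab⟩ := N.leftBounded
  refine ⟨a, b, fun i j p hij => ?_⟩
  change Subsingleton (N.gr (i, j, p))
  rw [hab i j p hij]
  infer_instance

/-- The graded dimension. -/
def gdim (N : SMod.{u} k) : Ser := (exists_isGdim N.isLocallyFiniteBounded).choose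

lemma isGdim (N : SMod.{u} k) : IsGdim (fun d => N.gr d) N.gdim :=
  (exists_isGdim N.isLocallyFiniteBounded).choose_spec

lemma gdim_eq_zero (N : SMod.{u} k) [Subsingleton N.carrier] : N.gdim = 0 :=
  N.isGdim.unique fun i j => by
    rw [Module.finrank_zero_of_subsingleton, Module.finrank_zero_of_subsingleton]
    simp

/-- Graded dimensions are additive on short exact sequences. -/
lemma gdim_of_exact {A B C : SMod.{u} k} (f : A.carrier →ₗ[Omega k] B.carrier)
    (h : B.carrier →ₗ[Omega k] C.carrier) (hf : ∀ d, ∀ v ∈ A.gr d, f v ∈ B.gr d)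
    (hh : ∀ d, ∀ v ∈ B.gr d, h v ∈ C.gr d) (hinj : Function.Injective f)
    (hex : Function.Exact f h) (hsurj : Function.Surjective h) :
    B.gdim = A.gdim + C.gdim := by
  have key : ∀ d, Module.finrank ℚ (B.gr d) =
      Module.finrank ℚ (A.gr d) + Module.finrank ℚ (C.gr d) := by
    intro d
    obtain ⟨pA, pA1, pA2, pA3⟩ := exists_proj A.internal
    obtain ⟨pB, pB1, pB2, pB3⟩ := exists_proj B.internal
    obtain ⟨pC, pC1, pC2, pC3⟩ := exists_proj C.internal
    -- Degree-preserving maps commute with degree projections. Hence preimages under `f` and `h` may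
    -- be replaced by homogeneous ones, and exactness passes to each degree.
    have comm : ∀ {A B : SMod.{u} k} (f : A.carrier →ₗ[Omega k] B.carrier)
        (_ : ∀ d, ∀ v ∈ A.gr d, f v ∈ B.gr d) {pA : Deg → A.carrier →ₗ[ℚ] A.carrier}
        {pB : Deg → B.carrier →ₗ[ℚ] B.carrier} (_ : ∀ d, ∀ v ∈ A.gr d, pA d v = v)
        (_ : ∀ d e, ∀ v ∈ A.gr e, e ≠ d → pA d v = 0) (_ : ∀ d, ∀ v ∈ B.gr d, pB d v = v)
        (_ : ∀ d e, ∀ v ∈ B.gr e, e ≠ d → pB d v = 0) (v : A.carrier),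
        f (pA d v) = pB d (f v) := by
      intro A B f hf pA pB a1 a2 b1 b2 v
      have hv : v ∈ ⨆ d, A.gr d := A.internal.submodule_iSup_eq_top ▸ Submodule.mem_top
      induction hv using Submodule.iSup_induction' with
      | mem e v hv =>
        by_cases h : e = d
        · subst h; rw [a1 e v hv, b1 e _ (hf e v hv)]
        · rw [a2 d e v hv h, b2 d e _ (hf e v hv) h, map_zero]
      | zero => simp
      | add x y _ _ hx hy => rw [map_add, map_add, map_add, map_add, hx, hy]
    let fd : A.gr d →ₗ[ℚ] B.gr d := (f.restrictScalars ℚ).restrict (hf d)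
    let hd : B.gr d →ₗ[ℚ] C.gr d := (h.restrictScalars ℚ).restrict (hh d)
    have fin : Module.Finite ℚ (B.gr d) := B.locallyFinite d
    have fd_inj : Function.Injective fd := fun x y hxy =>
      Subtype.ext (hinj (congrArg Subtype.val hxy))
    have hd_surj : Function.Surjective hd := by
      rintro ⟨c, hc⟩
      obtain ⟨b, hb⟩ := hsurj c
      refine ⟨⟨pB d b, pB3 d b⟩, Subtype.ext ?_⟩
      change h (pB d b) = c
      rw [comm h hh pB1 pB2 pC1 pC2, hb, pC1 d c hc]
    have hker : LinearMap.ker hd = LinearMap.range fd := by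
      ext ⟨b, hb⟩
      constructor
      · intro h0
        have h1 : h b = 0 := congrArg Subtype.val h0
        obtain ⟨a, rfl⟩ := (hex b).1 h1
        refine ⟨⟨pA d a, pA3 d a⟩, Subtype.ext ?_⟩
        change f (pA d a) = f a
        rw [comm f hf pA1 pA2 pB1 pB2, pB1 d _ hb]
      · rintro ⟨a, ha⟩
        refine Subtype.ext ?_
        change h b = 0
        exact (hex b).2 ⟨a, congrArg Subtype.val ha⟩
    rw [← hd.finrank_range_add_finrank_ker, hker, LinearMap.finrank_range_of_inj fd_inj,
      LinearMap.range_eq_top.2 hd_surj, finrank_top, add_comm]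
  refine B.isGdim.unique fun i j => ?_
  rw [HahnSeries.coeff_add, HahnSeries.coeff_add, A.isGdim, C.isGdim, key, key]
  push_cast
  ring

section Basis

variable {P : SMod.{u} k} {A : Type*} (b : Module.Basis A (Omega k) P.carrier) {deg : A → Deg}

/-- Basis elements are nonzero, so their degrees lie where the module is nonzero. -/
lemma bounded_of_basis (hb : ∀ a, b a ∈ P.gr (deg a)) :
    ∃ i j : ℤ, ∀ a, i ≤ (deg a).1 ∧ j ≤ (deg a).2.1 := by
  obtain ⟨i, j, hij⟩ := P.leftBounded
  have : Nontrivial (Omega k) := ⟨⟨omegaBasis k (0, ∅), 0, (omegaBasis k).ne_zero _⟩⟩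
  refine ⟨i, j, fun a => ?_⟩
  by_contra hlt
  have h1 := hij (deg a).1 (deg a).2.1 (deg a).2.2 (by omega)
  have h2 := hb a
  rw [show deg a = ((deg a).1, (deg a).2.1, (deg a).2.2) from rfl, h1] at h2
  exact b.ne_zero a ((Submodule.mem_bot ℚ).1 h2)

lemma smul_mem_of_basis (hb : ∀ a, b a ∈ P.gr (deg a))
    (x : ((Fin k →₀ ℕ) × Finset (Fin k)) × A) :
    ((omegaBasis k).smulTower b) x ∈ P.gr (monDeg x.1 + deg x.2) := by
  rw [Module.Basis.smulTower_apply]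
  exact P.smul_mem _ _ _ _ (omegaBasis_mem x.1) (hb x.2)

/-- The graded dimension of a graded free module. -/
lemma gdim_of_count (hb : ∀ a, b a ∈ P.gr (deg a)) {c : Ser} (hc : IsCount deg c) :
    P.gdim = expand (shapCoef k) * c := by
  refine P.isGdim.unique fun i j => ?_
  rw [((isCount_monDeg k).mul hc).coeff_ncard]
  have h := finrank_gr P.internal ((omegaBasis k).smulTower b) (smul_mem_of_basis b hb)
  rw [h, h]

end Basis

lemma gdim_of_hasMult {P : SMod.{u} k} {c : Ser} (h : HasMult P c) :
    P.gdim = expand (shapCoef k) * c := by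
  obtain ⟨A, b, deg, hb, hfin, hc⟩ := h
  exact gdim_of_count b hb (IsCount.of_ncard (bounded_of_basis b hb) hfin hc)

/-- Graded projective modules are graded free. -/
lemma exists_basis (P : SMod.{u} k) [Module.Projective (Omega k) P.carrier] :
    ∃ (A : Type u) (b : Module.Basis A (Omega k) P.carrier) (deg : A → Deg),
      (∀ a, b a ∈ P.gr (deg a)) ∧ ∀ d, {a | deg a = d}.Finite := by
  obtain ⟨i, j, hij⟩ := P.leftBounded
  -- If the weight of `d` is below that of the corner `(i, j)`, then one of its two coordinates is
  -- below its bound, because the weight is monotone in both.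
  refine exists_homogeneous_basis (w := i + ((k : ℤ) + 1) * j) P.internal
    (fun l e v hv => P.smul_mem _ _ _ _ (omegaBasis_mem l) hv) (isConnectedBasis_omegaBasis k)
    (fun d hd => ?_) P.locallyFinite
  refine hij d.1 d.2.1 d.2.2 ?_
  by_contra! hge
  have hd' : d.1 + ((k : ℤ) + 1) * d.2.1 < i + ((k : ℤ) + 1) * j := hd
  have := mul_le_mul_of_nonneg_left hge.2 (show (0 : ℤ) ≤ (k : ℤ) + 1 by positivity)
  omega

/-- A graded free basis exists, and its generating series is recovered from the graded dimension by
cancelling the nonzero norm. So multiplicities do not depend on the basis. -/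
lemma hasMult_iff (P : SMod.{u} k) [Module.Projective (Omega k) P.carrier] (c : Ser) :
    HasMult P c ↔ P.gdim = expand (shapCoef k) * c := by
  refine ⟨gdim_of_hasMult, fun h => ?_⟩
  obtain ⟨A, b, deg, hb, hfin⟩ := P.exists_basis
  obtain ⟨c', hc'⟩ := IsCount.exists_of (bounded_of_basis b hb) (IsCount.fin_of_deg hfin)
  have h2 := gdim_of_count b hb hc'
  rw [h] at h2
  rw [mul_left_cancel₀ (expand_shapCoef_ne_zero k) h2]
  exact ⟨A, b, deg, hb, hfin, hc'.coeff_ncard⟩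

end SMod

/-! ## Homogeneous maps out of graded free modules -/

lemma coeff_qlam (i' j' i j : ℤ) :
    ((qlam i' j').coeff j).coeff i = if i' = i ∧ j' = j then 1 else 0 := by
  by_cases hj : j' = j
  · subst hj
    rw [qlam, HahnSeries.coeff_single_same]
    by_cases hi : i' = i
    · subst hi; simp
    · rw [HahnSeries.coeff_single_of_ne (Ne.symm hi), if_neg (fun h => hi h.1)]
  · rw [qlam, HahnSeries.coeff_single_of_ne (Ne.symm hj), if_neg (fun h => hj h.2)]
    rfl

lemma coeff_qlam_mul (i' j' i j : ℤ) (c : Ser) :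
    ((qlam i' j' * c).coeff j).coeff i = (c.coeff (j - j')).coeff (i - i') := by
  rw [qlam, HahnSeries.coeff_single_mul, HahnSeries.coeff_single_mul, one_mul]

lemma coeff_rat_smul (r : ℚ) (c : Ser) (i j : ℤ) :
    ((r • c).coeff j).coeff i = r * (c.coeff j).coeff i := by
  rw [HahnSeries.coeff_smul, HahnSeries.coeff_smul, smul_eq_mul]

lemma rat_smul_mul (r : ℚ) (c c' : Ser) : (r • c) * c' = r • (c * c') := by
  have h : ∀ c : Ser, r • c = HahnSeries.C (HahnSeries.C r) * c := fun c => ser_ext fun i j => by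
    rw [coeff_rat_smul, HahnSeries.C_apply, HahnSeries.coeff_single_zero_mul, HahnSeries.C_apply,
      HahnSeries.coeff_single_zero_mul]
  rw [h, h, mul_assoc]

lemma coeff_finset_sum {A : Type*} (s : Finset A) (f : A → Ser) (i j : ℤ) :
    ((∑ a ∈ s, f a).coeff j).coeff i = ∑ a ∈ s, ((f a).coeff j).coeff i := by
  rw [HahnSeries.coeff_sum, HahnSeries.coeff_sum]

lemma IsCount.eq_sum {A : Type*} [Fintype A] {deg : A → Deg} {c : Ser} (h : IsCount deg c) :
    c = ∑ a, sgn (deg a).2.2 • qlam (deg a).1 (deg a).2.1 := by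
  refine ser_ext fun i j => ?_
  rw [h.coeff, coeff_finset_sum]
  simp only [coeff_rat_smul, coeff_qlam, mul_ite, mul_one, mul_zero]
  rw [← Finset.sum_filter]
  refine Finset.sum_congr ?_ fun _ _ => rfl
  ext a
  simp

/-- The monomial `q^i λ^j` in `ℚ(q)[λ, λ⁻¹]`. -/
def qlamPoly (i j : ℤ) : KL := LaurentPolynomial.C (q ^ i) * LaurentPolynomial.T j

lemma expand_qlamPoly (i j : ℤ) : expand (qlamPoly i j) = qlam i j := expand_monomial i j

lemma bar_qlamPoly (i j : ℤ) : bar (qlamPoly i j) = qlamPoly (-i) (-j) := by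
  rw [qlamPoly, map_mul, bar_C, bar_T, barK_zpow, qlamPoly]

namespace SMod

variable {k : ℕ} {P N : SMod.{u} k} {A : Type*} (b : Module.Basis A (Omega k) P.carrier)
  {deg : A → Deg}

/-- The linear map with prescribed values on a basis that commutes with `Ω_k` up to the sign
`(-1)^{p p(r)}`. -/
def superConstr (p : ZMod 2) (n : A → N.carrier) : P.carrier →ₗ[ℚ] N.carrier :=
  Finsupp.lsum ℚ (fun a => ((LinearMap.toSpanSingleton (Omega k) N.carrier (n a)).restrictScalars ℚ)
    ∘ₗ twist k p) ∘ₗ (b.repr.toLinearMap.restrictScalars ℚ)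

lemma superConstr_smul_basis (p : ZMod 2) (n : A → N.carrier) (r : Omega k) (a : A) :
    superConstr b p n (r • b a) = twist k p r • n a := by
  simp only [superConstr, LinearMap.comp_apply, LinearMap.restrictScalars_apply,
    LinearEquiv.coe_coe, map_smul, b.repr_self, Finsupp.smul_single, smul_eq_mul, mul_one]
  rw [Finsupp.lsum_single]
  rfl

lemma superConstr_smul (p : ZMod 2) (n : A → N.carrier) (r : Omega k) (v : P.carrier) :
    superConstr b p n (r • v) = twist k p r • superConstr b p n v := by
  rw [← b.linearCombination_repr v, Finsupp.linearCombination_apply, Finsupp.sum, Finset.smul_sum, map_sum, map_sum, Finset.smul_sum]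
  refine Finset.sum_congr rfl fun a _ => ?_
  rw [smul_smul, superConstr_smul_basis, superConstr_smul_basis, twist_mul, mul_smul]

lemma superConstr_basis (p : ZMod 2) (n : A → N.carrier) (a : A) :
    superConstr b p n (b a) = n a := by
  have := superConstr_smul_basis b p n 1 a
  rwa [one_smul, twist_one, one_smul] at this

/-- Homogeneity can be checked on the rational basis of monomials times generators; the sign rule is
the twisted linearity of `superConstr`. -/
lemma superConstr_mem (hb : ∀ a, b a ∈ P.gr (deg a)) (d : Deg) (n : ∀ a, N.gr (d + deg a)) :
    superConstr b d.2.2 (fun a => (n a : N.carrier)) ∈ homGr P N d := by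
  refine ⟨fun e v hv => ?_, fun e r v hr => ?_⟩
  · rw [gr_eq_span P.internal ((omegaBasis k).smulTower b) (smul_mem_of_basis b hb) e] at hv
    induction hv using Submodule.span_induction with
    | mem x hx =>
      obtain ⟨⟨l, a⟩, rfl, rfl⟩ := hx
      rw [Module.Basis.smulTower_apply, superConstr_smul_basis, twist_of_mem _ (omegaBasis_mem l),
        smul_assoc]
      refine Submodule.smul_mem _ _ ?_
      have := N.smul_mem _ _ _ _ (omegaBasis_mem l) (n a).2
      rwa [add_left_comm] at this
    | zero => rw [map_zero]; exact Submodule.zero_mem _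
    | add x y _ _ hx hy => rw [map_add]; exact Submodule.add_mem _ hx hy
    | smul c x _ hx => rw [map_smul]; exact Submodule.smul_mem _ _ hx
  · rw [superConstr_smul, twist_of_mem _ hr, smul_assoc]

lemma homGr_ext {d : Deg} {f g : P.carrier →ₗ[ℚ] N.carrier} (hf : f ∈ homGr P N d)
    (hg : g ∈ homGr P N d) (h : ∀ a, f (b a) = g (b a)) : f = g := by
  refine ((omegaBasis k).smulTower b).ext ?_
  rintro ⟨l, a⟩
  rw [Module.Basis.smulTower_apply, hf.2 _ _ _ (omegaBasis_mem l), hg.2 _ _ _ (omegaBasis_mem l), h]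

/-- Homogeneous maps out of a graded free module are determined by their values on a basis. -/
def homGrEquiv (hb : ∀ a, b a ∈ P.gr (deg a)) (d : Deg) :
    homGr P N d ≃ₗ[ℚ] ((a : A) → N.gr (d + deg a)) :=
  LinearEquiv.ofBijective
    { toFun := fun f a => ⟨f.1 (b a), f.2.1 _ _ (hb a)⟩
      map_add' := fun _ _ => rfl
      map_smul' := fun _ _ => rfl }
    ⟨fun f g h => Subtype.ext (homGr_ext b f.2 g.2 fun a =>
        congrArg Subtype.val (congrFun h a)),
      fun n => ⟨⟨_, superConstr_mem b hb d n⟩, funext fun a =>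
        Subtype.ext (superConstr_basis b _ _ a)⟩⟩

lemma homGr_isLocallyFiniteBounded [Finite A] (hb : ∀ a, b a ∈ P.gr (deg a)) :
    IsLocallyFiniteBounded (fun d => homGr P N d) := by
  have := Fintype.ofFinite A
  refine ⟨fun d => ?_, ?_⟩
  · have := fun a => N.locallyFinite (d + deg a)
    exact Module.Finite.equiv (homGrEquiv b hb d).symm
  · obtain ⟨i, j, hij⟩ := N.leftBounded
    -- Maps lower degrees by the degrees of the generators, so an upper bound on the latter is
    -- needed. Here finiteness of the basis enters.
    obtain ⟨i', hi'⟩ := (Set.finite_range fun a => (deg a).1).bddAbove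
    obtain ⟨j', hj'⟩ := (Set.finite_range fun a => (deg a).2.1).bddAbove
    refine ⟨i - i', j - j', fun i₀ j₀ p h => ?_⟩
    have : ∀ a, Subsingleton (N.gr ((i₀, j₀, p) + deg a)) := fun a => by
      have h1 : (deg a).1 ≤ i' := hi' ⟨a, rfl⟩
      have h2 : (deg a).2.1 ≤ j' := hj' ⟨a, rfl⟩
      have h3 := hij (i₀ + (deg a).1) (j₀ + (deg a).2.1) (p + (deg a).2.2) (by omega)
      rw [show ((i₀, j₀, p) + deg a : Deg) =
        (i₀ + (deg a).1, j₀ + (deg a).2.1, p + (deg a).2.2) from rfl, h3]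
      infer_instance
    exact (homGrEquiv b hb (i₀, j₀, p)).toEquiv.subsingleton

/-- Each generator contributes a copy of `N` shifted down by its degree. Its parity only exchanges
the even and odd parts, which is the sign `sgn`. -/
lemma homGr_isGdim [Fintype A] (hb : ∀ a, b a ∈ P.gr (deg a)) :
    IsGdim (fun d => homGr P N d)
      ((∑ a, sgn (deg a).2.2 • qlam (-(deg a).1) (-(deg a).2.1)) * N.gdim) := by
  intro i j
  have hfin : ∀ d a, Module.Finite ℚ (N.gr (d + deg a)) := fun d a => N.locallyFinite _
  have key : ∀ d, Module.finrank ℚ (homGr P N d) = ∑ a, Module.finrank ℚ (N.gr (d + deg a)) :=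
    fun d => by rw [(homGrEquiv b hb d).finrank_eq, Module.finrank_pi_fintype]
  rw [key, key, Finset.sum_mul, coeff_finset_sum]
  push_cast
  rw [← Finset.sum_sub_distrib]
  refine Finset.sum_congr rfl fun a _ => ?_
  rw [rat_smul_mul, coeff_rat_smul, coeff_qlam_mul, N.isGdim]
  have hp : ∀ p : ZMod 2, p = 0 ∨ p = 1 := by decide
  have e : ∀ p, ((i, j, p) + deg a : Deg) =
      (i - -(deg a).1, j - -(deg a).2.1, p + (deg a).2.2) := fun p => by
    simp only [sub_neg_eq_add]; rfl
  rw [e, e]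
  rcases hp (deg a).2.2 with h | h
  · rw [h, sgn_zero, one_mul, add_zero, add_zero]
  · rw [h, sgn_one, zero_add, show (1 + 1 : ZMod 2) = 0 by decide]
    ring

/-- Finitely generated projectives have a finite homogeneous basis. -/
lemma exists_finite_basis (P : SMod.{u} k) [Module.Finite (Omega k) P.carrier]
    [Module.Projective (Omega k) P.carrier] :
    ∃ (A : Type u) (_ : Fintype A) (b : Module.Basis A (Omega k) P.carrier) (deg : A → Deg),
      (∀ a, b a ∈ P.gr (deg a)) ∧ P.gdim =
        expand (shapCoef k) * ∑ a, sgn (deg a).2.2 • qlam (deg a).1 (deg a).2.1 := by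
  obtain ⟨A, b, deg, hb, hfin⟩ := P.exists_basis
  have : Nontrivial (Omega k) := ⟨⟨omegaBasis k (0, ∅), 0, (omegaBasis k).ne_zero _⟩⟩
  have : Finite A := Module.Finite.finite_basis b
  have hA := Fintype.ofFinite A
  obtain ⟨c, hc⟩ := IsCount.exists_of (bounded_of_basis b hb) (IsCount.fin_of_deg hfin)
  exact ⟨A, hA, b, deg, hb, hc.eq_sum ▸ gdim_of_count b hb hc⟩

/-- The class of a finitely generated projective determines the graded dimensions of the spaces of
homogeneous maps. -/
lemma exists_class (P : SMod.{u} k) [Module.Finite (Omega k) P.carrier]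
    [Module.Projective (Omega k) P.carrier] :
    ∃ f : KL, P.gdim = expand (shapCoef k) * expand f ∧ ∀ N : SMod.{u} k,
      IsLocallyFiniteBounded (fun d => homGr P N d) ∧
      IsGdim (fun d => homGr P N d) (expand (bar f) * N.gdim) := by
  obtain ⟨A, hA, b, deg, hb, hP⟩ := P.exists_finite_basis
  -- Since the basis is finite, its generating series is a Laurent polynomial, to which the bar
  -- involution applies.
  refine ⟨∑ a, sgn (deg a).2.2 • qlamPoly (deg a).1 (deg a).2.1, ?_, fun N =>
    ⟨homGr_isLocallyFiniteBounded b hb, ?_⟩⟩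
  · rw [hP, map_sum]
    simp only [map_rat_smul, expand_qlamPoly]
  · rw [map_sum, map_sum]
    simp only [map_rat_smul, bar_qlamPoly, expand_qlamPoly]
    exact homGr_isGdim b hb

end SMod

/-! ## Grothendieck groups -/

lemma CatM.gdim_support (N : CatM.{u}) (k : ℕ) (h : (N.comp k).gdim ≠ 0) :
    k ∈ N.finite.toFinset := by
  rw [Set.Finite.mem_toFinset]
  intro hs
  exact h (N.comp k).gdim_eq_zero

lemma IsShortExact.gdim {A B C : CatM.{u}} (h : IsShortExact A B C) (k : ℕ) :
    (B.comp k).gdim = (A.comp k).gdim + (C.comp k).gdim := by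
  obtain ⟨f, g, hf, hg, hinj, hex, hsurj⟩ := h k
  exact SMod.gdim_of_exact f g hf hg hinj hex hsurj

/-- Lets additivity on `K0` follow from the same count of dimensions as additivity on `G0`. -/
lemma IsDirectSum.isShortExact {A B C : CatM.{u}} (h : IsDirectSum A B C) :
    IsShortExact A B C := by
  intro k
  obtain ⟨e, he⟩ := h k
  refine ⟨e.symm.toLinearMap ∘ₗ LinearMap.inl _ _ _, LinearMap.snd _ _ _ ∘ₗ e.toLinearMap,
    fun d v hv => ?_, fun d v hv => ((he d v).1 hv).2, ?_, ?_, ?_⟩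
  · rw [he]
    simp [hv]
  · exact e.symm.injective.comp LinearMap.inl_injective
  · intro v
    constructor
    · intro hv
      refine ⟨(e v).1, e.injective ?_⟩
      have hv : (e v).2 = 0 := hv
      simp [Prod.ext_iff, hv]
    · rintro ⟨a, rfl⟩
      simp
  · exact Prod.snd_surjective.comp e.surjective

/-- The class of a finitely generated projective object in the Verma module. -/
lemma exists_projClass (M : {M : CatM.{u} // IsFgProj M}) :
    ∃ x : Verma KL, ∀ k, (M.1.comp k).gdim = expand (shapCoef k) * expand (x k) := by
  have h : ∀ k, ∃ f : KL, (M.1.comp k).gdim = expand (shapCoef k) * expand f := fun k => by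
    have := (M.2 k).1
    have := (M.2 k).2
    obtain ⟨f, hf, -⟩ := (M.1.comp k).exists_class
    exact ⟨f, hf⟩
  choose f hf using h
  refine ⟨Finsupp.onFinset M.1.finite.toFinset f fun k hk => M.1.gdim_support k ?_, hf⟩
  rw [hf]
  exact mul_ne_zero (expand_shapCoef_ne_zero k) ((map_ne_zero_iff _ expand_injective).2 hk)

lemma projClass_unique {k : ℕ} {f f' : KL} {c : Ser} (h : c = expand (shapCoef k) * expand f)
    (h' : c = expand (shapCoef k) * expand f') : f = f' :=
  expand_injective (mul_left_cancel₀ (expand_shapCoef_ne_zero k) (h.symm.trans h'))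

/-- Removes bases from the description of the map, leaving an equation of series that is visibly
additive. -/
lemma isK0Map_iff (γ : K0.{u} →+ Verma KL) : IsK0Map γ ↔ ∀ M k,
    (M.1.comp k).gdim = expand (shapCoef k) * expand (γ (K0.mk M) k) := by
  refine forall_congr' fun M => forall_congr' fun k => ?_
  have := (M.2 k).2
  exact (M.1.comp k).hasMult_iff _

/-- The common universal property of the two Grothendieck groups: a function additive on the
relation `r` extends uniquely. -/
lemma existsUnique_lift {α G : Type*} [AddCommGroup G] (r : α → α → α → Prop) (x : α → G)
    (h : ∀ A B C, r A B C → x B = x A + x C) :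
    ∃! γ : (FreeAbelianGroup α ⧸ AddSubgroup.closure {z | ∃ A B C : α, r A B C ∧
      z = FreeAbelianGroup.of B - FreeAbelianGroup.of A - FreeAbelianGroup.of C}) →+ G,
      ∀ a, γ (QuotientAddGroup.mk (FreeAbelianGroup.of a)) = x a := by
  have hle : AddSubgroup.closure {z | ∃ A B C : α, r A B C ∧
      z = FreeAbelianGroup.of B - FreeAbelianGroup.of A - FreeAbelianGroup.of C} ≤
      (FreeAbelianGroup.lift x).ker := by
    rw [AddSubgroup.closure_le]
    rintro _ ⟨A, B, C, hr, rfl⟩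
    rw [SetLike.mem_coe, AddMonoidHom.mem_ker, map_sub, map_sub, FreeAbelianGroup.lift_apply_of,
      FreeAbelianGroup.lift_apply_of, FreeAbelianGroup.lift_apply_of, h A B C hr]
    abel
  refine ⟨QuotientAddGroup.lift _ (FreeAbelianGroup.lift x) hle,
    fun a => FreeAbelianGroup.lift_apply_of x a, fun γ hγ => ?_⟩
  refine QuotientAddGroup.addMonoidHom_ext _ (FreeAbelianGroup.lift_ext _ _ fun a => ?_)
  exact (hγ a).trans (FreeAbelianGroup.lift_apply_of x a).symm

theorem existsUnique_k0Map : ∃! γ : K0.{u} →+ Verma KL, IsK0Map γ := by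
  choose x hx using exists_projClass.{u}
  refine (existsUnique_congr fun γ => ?_).2 (existsUnique_lift
    (fun A B C : {M : CatM.{u} // IsFgProj M} => IsDirectSum A.1 B.1 C.1) x fun A B C h => ?_)
  · rw [isK0Map_iff]
    refine forall_congr' fun M => ⟨fun h => Finsupp.ext fun k => projClass_unique (h k) (hx M k),
      fun h k => ?_⟩
    rw [hx M k, K0.mk, h]
  · refine Finsupp.ext fun k => projClass_unique (hx B k) ?_
    rw [h.isShortExact.gdim k, hx A k, hx C k, Finsupp.add_apply, map_add, mul_add]

/-- The coordinates of the class of an object in the completed Verma module. -/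
lemma isG0Map_iff {B : Form} (hB : IsShapovalov B) {d : ℕ → Verma Ser} (hd : IsDualCanonical B d)
    (γ : G0.{u} →+ Verma Ser) : IsG0Map d γ ↔ ∀ N k,
      (N.comp k).gdim = expand (shapCoef k) * γ (G0.mk N) k := by
  rw [(hB.isDualCanonical_iff d).1 hd]
  -- In terms of the `m_k`, the dual canonical vector `m^k` is the inverse norm in position `k`.
  have key : ∀ (c : ℕ →₀ Ser) (k : ℕ), (c.sum fun k a => a •
      (Finsupp.single k (expand (shapCoef k))⁻¹ : Verma Ser)) k = c k * (expand (shapCoef k))⁻¹ := by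
    intro c k
    rw [Finsupp.sum, Finsupp.finsetSum_apply, Finset.sum_eq_single k]
    · rw [Finsupp.smul_apply, Finsupp.single_eq_same, smul_eq_mul]
    · intro j _ hj
      rw [Finsupp.smul_apply, Finsupp.single_eq_of_ne (Ne.symm hj), smul_zero]
    · intro hk
      rw [Finsupp.notMem_support_iff.1 hk, Finsupp.smul_apply, smul_eq_mul, zero_mul]
  have hinv : ∀ k, expand (shapCoef k) * (expand (shapCoef k))⁻¹ = 1 := fun k =>
    mul_inv_cancel₀ (G₀ := Ser) (expand_shapCoef_ne_zero k)
  refine forall_congr' fun N => ⟨?_, fun h => ?_⟩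
  · rintro ⟨c, hc, hγ⟩ k
    rw [hγ, key, (N.comp k).isGdim.unique (hc k)]
    linear_combination (-c k) * hinv k
  · refine ⟨Finsupp.onFinset N.finite.toFinset (fun k => (N.comp k).gdim)
      (N.gdim_support), fun k => (N.comp k).isGdim, Finsupp.ext fun k => ?_⟩
    rw [key, Finsupp.onFinset_apply, h k]
    linear_combination (-γ (G0.mk N) k) * hinv k

/-- The coordinate at `k` has to be the graded dimension of the `k`-th component divided by the
norm. -/
theorem existsUnique_g0Map {B : Form} (hB : IsShapovalov B) {d : ℕ → Verma Ser}
    (hd : IsDualCanonical B d) : ∃! γ : G0.{u} →+ Verma Ser, IsG0Map d γ := by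
  have hinv : ∀ k, expand (shapCoef k) * (expand (shapCoef k))⁻¹ = 1 := fun k =>
    mul_inv_cancel₀ (G₀ := Ser) (expand_shapCoef_ne_zero k)
  have hx : ∀ N : CatM.{u}, ∃ x : Verma Ser, ∀ k,
      (N.comp k).gdim = expand (shapCoef k) * x k := fun N =>
    ⟨Finsupp.onFinset N.finite.toFinset (fun k => (expand (shapCoef k))⁻¹ * (N.comp k).gdim)
      fun k hk => N.gdim_support k (right_ne_zero_of_mul hk), fun k => by
        rw [Finsupp.onFinset_apply, ← mul_assoc, hinv, one_mul]⟩
  choose x hx using hx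
  refine (existsUnique_congr fun γ => ?_).2 (existsUnique_lift IsShortExact x fun A B C h => ?_)
  · rw [isG0Map_iff hB hd]
    refine forall_congr' fun N => ⟨fun h => Finsupp.ext fun k => ?_, fun h k => ?_⟩
    · exact mul_left_cancel₀ (expand_shapCoef_ne_zero k) ((h k).symm.trans (hx N k))
    · rw [hx N k, G0.mk, h]
  · refine Finsupp.ext fun k => mul_left_cancel₀ (expand_shapCoef_ne_zero k) ?_
    rw [← hx B k, h.gdim k, hx A k, hx C k, Finsupp.add_apply, mul_add]

/-! ## The pairing -/

lemma homGr_subsingleton {k : ℕ} {M N : SMod.{u} k} [Subsingleton M.carrier] (d : Deg) :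
    Subsingleton (homGr M N d) :=
  ⟨fun f g => Subtype.ext (LinearMap.ext fun v => by
    rw [Subsingleton.elim v 0, map_zero, map_zero])⟩

/-- Only finitely many components contribute to the spaces of homogeneous maps. -/
def homEquivPi (M N : CatM.{u}) (d : Deg) :
    HOM M N d ≃ₗ[ℚ] ((k : M.finite.toFinset) → homGr (M.comp k) (N.comp k) d) :=
  LinearEquiv.ofBijective
    ({ toFun := fun f k => f k
       map_add' := fun _ _ => rfl
       map_smul' := fun _ _ => rfl } : HOM M N d →ₗ[ℚ]
      ((k : M.finite.toFinset) → homGr (M.comp k) (N.comp k) d))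
    ⟨fun f g h => funext fun k => by
        by_cases hk : k ∈ M.finite.toFinset
        · exact congrFun h ⟨k, hk⟩
        · have : Subsingleton (M.comp k).carrier := by
            by_contra hs
            exact hk (by rw [Set.Finite.mem_toFinset]; exact hs)
          exact (homGr_subsingleton d).elim _ _,
      fun f => ⟨fun k => if hk : k ∈ M.finite.toFinset then f ⟨k, hk⟩ else 0, funext fun k => by
        dsimp only [LinearMap.coe_mk, AddHom.coe_mk]
        rw [dif_pos k.2]⟩⟩

lemma hom_isLocallyFiniteBounded {M N : CatM.{u}}
    (h : ∀ k, IsLocallyFiniteBounded (fun d => homGr (M.comp k) (N.comp k) d)) :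
    IsLocallyFiniteBounded (HOM M N) := by
  refine ⟨fun d => ?_, ?_⟩
  · have := fun k : M.finite.toFinset => (h k).1 d
    exact Module.Finite.equiv (homEquivPi M N d).symm
  · choose a b hab using fun k => (h k).2
    obtain ⟨a', ha'⟩ := (Set.finite_range fun k : M.finite.toFinset => a k).bddBelow
    obtain ⟨b', hb'⟩ := (Set.finite_range fun k : M.finite.toFinset => b k).bddBelow
    refine ⟨a', b', fun i j p hij => ?_⟩
    have : ∀ k : M.finite.toFinset, Subsingleton (homGr (M.comp k) (N.comp k) (i, j, p)) :=
      fun k => hab k i j p (by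
        have h1 : a' ≤ a k := ha' ⟨k, rfl⟩
        have h2 : b' ≤ b k := hb' ⟨k, rfl⟩
        omega)
    exact (homEquivPi M N (i, j, p)).toEquiv.subsingleton

lemma hom_isGdim {M N : CatM.{u}} {c : ℕ → Ser}
    (hfin : ∀ k, IsLocallyFiniteBounded (fun d => homGr (M.comp k) (N.comp k) d))
    (h : ∀ k, IsGdim (fun d => homGr (M.comp k) (N.comp k) d) (c k)) :
    IsGdim (HOM M N) (∑ k ∈ M.finite.toFinset, c k) := by
  intro i j
  have key : ∀ d, Module.finrank ℚ (HOM M N d) =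
      ∑ k : M.finite.toFinset, Module.finrank ℚ (homGr (M.comp k) (N.comp k) d) := fun d => by
    have := fun k : M.finite.toFinset => (hfin k).1 d
    rw [(homEquivPi M N d).finrank_eq, Module.finrank_pi_fintype]
  rw [key, key, coeff_finset_sum, ← Finset.sum_coe_sort]
  push_cast
  rw [← Finset.sum_sub_distrib]
  exact Finset.sum_congr rfl fun k _ => h k i j

/-- The `k`-th term of the form is `bar (x k)` times the norm times `y k`. The last two factors make
up the graded dimension of `N_k`, and the product is that of the maps `M_k → N_k`. -/
theorem hom_pairing {B : Form} (hB : IsShapovalov B) {M N : CatM.{u}} (hM : IsFgProj M)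
    {x : Verma KL} (hx : ∀ k, (M.comp k).gdim = expand (shapCoef k) * expand (x k))
    {y : Verma Ser} (hy : ∀ k, (N.comp k).gdim = expand (shapCoef k) * y k) :
    IsLocallyFiniteBounded (HOM M N) ∧ IsGdim (HOM M N) (extend B x y) := by
  have h : ∀ k, IsLocallyFiniteBounded (fun d => homGr (M.comp k) (N.comp k) d) ∧
      IsGdim (fun d => homGr (M.comp k) (N.comp k) d) (expand (bar (x k)) * (N.comp k).gdim) := by
    intro k
    have := (hM k).1
    have := (hM k).2
    obtain ⟨f, hf, hN⟩ := (M.comp k).exists_class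
    rw [projClass_unique (hx k) hf]
    exact hN (N.comp k)
  refine ⟨hom_isLocallyFiniteBounded fun k => (h k).1, ?_⟩
  have e : extend B x y = ∑ k ∈ M.finite.toFinset, expand (bar (x k)) * (N.comp k).gdim := by
    rw [hB.extend_eq, Finsupp.sum]
    simp only [hy]
    have hx0 : ∀ k, k ∉ M.finite.toFinset → x k = 0 := fun k hk => by
      have h0 : (M.comp k).gdim = 0 := by
        by_contra hne
        exact hk (M.gdim_support k hne)
      refine projClass_unique (k := k) ((hx k).symm.trans h0).symm ?_
      rw [map_zero, mul_zero]
    -- One sum runs over the support of `y`, the other over the nonzero components of `M`. Outside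
    -- the common indices one of the factors `x k`, `y k` is zero.
    refine Finset.sum_congr_of_eq_on_inter (fun k _ hk => ?_) (fun k _ hk => ?_) fun k _ _ => by ring
    · rw [hx0 k hk, map_zero, map_zero, zero_mul, mul_zero]
    · rw [Finsupp.notMem_support_iff.1 hk, mul_zero, mul_zero]
  rw [e]
  exact hom_isGdim (fun k => (h k).1) fun k => (h k).2

end VermaCat

end

/-! ### The main theorem -/

theorem mainTheorem4 :
    (∃! B : VermaCat.Verma VermaCat.KL →ₛₗ[VermaCat.bar]
        VermaCat.Verma VermaCat.KL →ₗ[VermaCat.KL] VermaCat.KL, VermaCat.IsShapovalov B) ∧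
    (∃! γ : VermaCat.K0.{u} →+ VermaCat.Verma VermaCat.KL, VermaCat.IsK0Map γ) ∧
    ∀ B : VermaCat.Verma VermaCat.KL →ₛₗ[VermaCat.bar]
        VermaCat.Verma VermaCat.KL →ₗ[VermaCat.KL] VermaCat.KL, VermaCat.IsShapovalov B →
      (∃! d, VermaCat.IsDualCanonical B d) ∧
      ∀ d, VermaCat.IsDualCanonical B d →
        (∃! γ' : VermaCat.G0.{u} →+ VermaCat.Verma VermaCat.Ser, VermaCat.IsG0Map d γ') ∧
        ∀ γ : VermaCat.K0.{u} →+ VermaCat.Verma VermaCat.KL, VermaCat.IsK0Map γ →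
        ∀ γ' : VermaCat.G0.{u} →+ VermaCat.Verma VermaCat.Ser, VermaCat.IsG0Map d γ' →
          (∀ N : VermaCat.CatM.{u}, VermaCat.IsProj N →
            ∀ y, VermaCat.IsProjClass N y ↔ y = γ' (VermaCat.G0.mk N)) ∧
          ∀ (M : {M : VermaCat.CatM.{u} // VermaCat.IsFgProj M}) (N : VermaCat.CatM.{u}),
            VermaCat.IsLocallyFiniteBounded (VermaCat.HOM M.1 N) ∧
            VermaCat.IsGdim (VermaCat.HOM M.1 N)
              (VermaCat.extend B (γ (VermaCat.K0.mk M)) (γ' (VermaCat.G0.mk N))) := by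
  open VermaCat in
  refine ⟨existsUnique_shapovalov, existsUnique_k0Map, fun B hB => ⟨⟨_,
    (hB.isDualCanonical_iff _).2 rfl, fun d hd => (hB.isDualCanonical_iff d).1 hd⟩, fun d hd =>
    ⟨existsUnique_g0Map hB hd, fun γ hγ γ' hγ' => ?_⟩⟩⟩
  rw [VermaCat.isK0Map_iff] at hγ
  rw [VermaCat.isG0Map_iff hB hd] at hγ'
  refine ⟨fun N hN y => ?_, fun M N => VermaCat.hom_pairing hB M.2 (hγ M) (hγ' N)⟩
  -- For projective `N_k`, the multiplicity series and the `G0`-coordinate solve the same linear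
  -- equation, with the norm as nonzero coefficient.
  have h : ∀ k, VermaCat.HasMult (N.comp k) (y k) ↔ y k = γ' (VermaCat.G0.mk N) k := fun k => by
    have := hN k
    rw [(N.comp k).hasMult_iff, hγ' N k]
    exact ⟨fun h => (mul_left_cancel₀ (VermaCat.expand_shapCoef_ne_zero k) h).symm,
      fun h => by rw [h]⟩
  exact (forall_congr' h).trans Finsupp.ext_iff.symm
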